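/- Let $n\ge 1$, and let $\mathbb{R}^{n+1}$ carry its standard flat connection $D$ and volume form $\Psi=dx^1\wedge\dots\wedge dx^{n+1}$. For a smooth function $F$ write $F_i=\partial_iF$, $F_{ij}=\partial_i\partial_jF$, $\mathcal H(F)=\det(F_{ij})$ and $\mathcal U(F)=U^{ij}F_iF_j$, where $U^{ij}$ is the adjugate of $F_{ij}$; where $\mathcal H(F)\ne 0$ put $F^i=g^{ij}F_j$, where $g^{ij}$ is the inverse of $F_{ij}$. Affine spheres. The equiaffine normal of a co-oriented nondegenerate smooth hypersurface $M$ is the transverse field $\xi$ along $M$, on the side given by the co-orientation, such that for $X,Y$ tangent to $M$ one has $D_XY=\nabla_XY+h(X,Y)\xi$ and $D_X\xi=-S(X)$ with $\nabla_XY$, $S(X)$ tangent to $M$, $h$ nondegenerate, and $|\det h(X_i,X_j)|=\Psi(\xi,X_1,\dots,X_n)^2$ for tangent $X_1,\dots,X_n$. Here $h$ is the equiaffine metric, and $\tfrac1n\operatorname{tr}S$ is the affine mean curvature. A co-oriented, possibly disconnected, $M$ is a proper affine sphere with centre $v$ if it is nondegenerate, all its equiaffine normal lines pass through $v$, its affine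 mean curvature is a nonzero constant (the same on all components), and the signatures modulo $4$ of $h$ on the components all agree. It is an improper affine sphere with equiaffine normal $cv$ if it is nondegenerate, $\xi=cv$ with a constant $c$ (the same on all components), its affine mean curvature is $0$, and the signatures modulo $4$ of $h$ on the components all agree. Theorem. Let $\epsilon\in\{0,1\}$ and let $\alpha,\lambda\in\mathbb{R}$ be not both $0$, with $\alpha\lambda=0$, $\alpha\epsilon=0$ and $\lambda\neq 1-\epsilon$. Let $\Omega\subset\mathbb{R}^{n+1}$ be nonempty and open, and let $I\subset\mathbb{R}$ be a nonempty open interval such that $\lambda r+\alpha\ne0$ for all $r\in I$. Let $v\in\mathbb{R}^{n+1}$, and let $F$ be continuous on $\Omega$, smooth on $\Omega\setminus\{F=-\alpha/\lambda\}$ (on all of $\Omega$ if $\lambda=0$), and such that $$F\big((1-\epsilon)(e^t(x-v)+v)+\epsilon(x+tv)\big)=e^{\lambda t}F(x)+\alpha t$$ whenever $t\in\mathbb{R}$ and both $x$ and $(1-\epsilon)(e^t(x-v)+v)+\epsilon(x+tv)$ are in $\Omega$. Let $\Omega_I=\Omega\cap F^{-1}(I)$ and $L_r=\{x\in\Omega: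 F(x)=r\}$. The following conditions are equivalent: 1. there is a nonvanishing function $\phi:I\to\mathbb{R}$ such that $\mathcal H(F)=\phi(F)$ on $\Omega_I$; 2. there is a nonvanishing function $\psi:I\to\mathbb{R}$ such that $\mathcal U(F)=\psi(F)$ on $\Omega_I$; 3. (if $\epsilon=0$) for every $r\in I$ the level set $L_r$, with its components co-oriented by $-\operatorname{sign}(\mathcal U(F)\mathcal H(F))F^i$, is a proper affine sphere with centre $v$; 4. (if $\epsilon=1$) for every $r\in I$ the level set $L_r$, with its components co-oriented by $-\operatorname{sign}(\mathcal U(F)\mathcal H(F))F^i$, is an improper affine sphere with equiaffine normal $cv$ for a constant $c$ that depends only on $r$. (In 3 and 4 an empty level set satisfies the condition trivially.) When these conditions hold and the set of values $F(\Omega_I)$ is connected (for instance if $\Omega$ is connected, or if $I\subset F(\Omega)$), there is a constant $B\neq0$ such that for all $r\in F(\Omega_I)$: - if $\alpha=0$, $\epsilon=0$: $\phi(r)=B|r|^{(n+1)(\lambda-2)/\lambda}$, $\psi(r)=\frac{\lambda}{\lambda-1}r\phi(r)$, and $L_r$ has affine mean curvature $$\operatorname{sign}(\lambda r)\,|\lambda-1|^{-\frac1{n+2}}\,|\lambda|^{-\frac{n+1}{n+2}}\,|B|^{\frac1{n+2}}\,|r|^{\frac{(n+1)(\lambda-2)}{(n+2)\lambda}-\frac{n+1}{n+2}};$$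 - if $\lambda=0$, $\epsilon=0$: $\phi(r)=Be^{-2(n+1)r/\alpha}$, $\psi(r)=-\alpha\phi(r)$, and $L_r$ has affine mean curvature $$\operatorname{sign}(\alpha)\,|\alpha|^{-\frac{n+1}{n+2}}\,|B|^{\frac1{n+2}}\,e^{-\frac{2(n+1)r}{\alpha(n+2)}};$$ - if $\alpha=0$, $\epsilon=1$: $\phi(r)=Br^{n+1}$, $\psi(r)=r\phi(r)$, and $L_r$ has affine mean curvature $0$. -/

import Mathlib

open scoped ContDiff Topology

noncomputable section

namespace AffineSphere

/-- The Hessian matrix `F_{ij}` of `F` at `x` in the standard (equiaffine) coordinates. -/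
def hess {n : ℕ} (F : (Fin (n + 1) → ℝ) → ℝ) (x : Fin (n + 1) → ℝ) :
    Matrix (Fin (n + 1)) (Fin (n + 1)) ℝ :=
  Matrix.of fun i j => fderiv ℝ (fderiv ℝ F) x (Pi.single i 1) (Pi.single j 1)

/-- The components `F_i` of the differential of `F` at `x`. -/
def diff {n : ℕ} (F : (Fin (n + 1) → ℝ) → ℝ) (x : Fin (n + 1) → ℝ) : Fin (n + 1) → ℝ :=
  fun i => fderiv ℝ F x (Pi.single i 1)

/-- The Hessian determinant `H(F)`. -/
def hessDet {n : ℕ} (F : (Fin (n + 1) → ℝ) → ℝ) (x : Fin (n + 1) → ℝ) : ℝ :=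
  (hess F x).det

/-- `U(F) = U^{ij} F_i F_j`, where `U^{ij}` is the adjugate of the Hessian. -/
def adjQuad {n : ℕ} (F : (Fin (n + 1) → ℝ) → ℝ) (x : Fin (n + 1) → ℝ) : ℝ :=
  diff F x ⬝ᵥ ((hess F x).adjugate.mulVec (diff F x))

/-- The vector field `F^i = g^{ij} F_j`, where `g^{ij}` is the inverse of the Hessian
(meaningful where `hessDet F` does not vanish). -/
def hessGrad {n : ℕ} (F : (Fin (n + 1) → ℝ) → ℝ) (x : Fin (n + 1) → ℝ) : Fin (n + 1) → ℝ :=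
  (hess F x)⁻¹.mulVec (diff F x)

/-- The vector field `-sign(U(F) H(F)) F^i`, which defines the standard co-orientation of the
level sets of `F`. -/
def stdCoorient {n : ℕ} (F : (Fin (n + 1) → ℝ) → ℝ) (x : Fin (n + 1) → ℝ) : Fin (n + 1) → ℝ :=
  (-Real.sign (adjQuad F x * hessDet F x)) • hessGrad F x

/-- `F` is continuous on `Ω`, smooth on `Ω` away from the level set `F = -α/λ` (nothing is removed
if `λ = 0`), and affinely homogeneous with centre (`ε = 0`) or axial centre (`ε = 1`) `v`. -/
structure IsAffinelyHomogeneous {n : ℕ} (lam ε α : ℝ) (Ω : Set (Fin (n + 1) → ℝ))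
    (v : Fin (n + 1) → ℝ) (F : (Fin (n + 1) → ℝ) → ℝ) : Prop where
  continuousOn : ContinuousOn F Ω
  smoothOn : ContDiffOn ℝ ∞ F (Ω \ {x | lam ≠ 0 ∧ F x = -α / lam})
  homogeneous : ∀ (t : ℝ), ∀ x ∈ Ω,
    (1 - ε) • (Real.exp t • (x - v) + v) + ε • (x + t • v) ∈ Ω →
      F ((1 - ε) • (Real.exp t • (x - v) + v) + ε • (x + t • v)) =
        Real.exp (lam * t) * F x + α * t

/-- `M` is a smooth embedded hypersurface: locally the zero set of a smooth function with
nonvanishing differential. -/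
def IsSmoothHypersurface {n : ℕ} (M : Set (Fin (n + 1) → ℝ)) : Prop :=
  ∀ x ∈ M, ∃ (W : Set (Fin (n + 1) → ℝ)) (G : (Fin (n + 1) → ℝ) → ℝ),
    IsOpen W ∧ x ∈ W ∧ ContDiffOn ℝ ∞ G W ∧ (∀ y ∈ W, fderiv ℝ G y ≠ 0) ∧
      M ∩ W = {y ∈ W | G y = 0}

/-- The tangent space of `M` at `x`: the span of the velocities at `x` of curves in `M`. -/
def tangent {n : ℕ} (M : Set (Fin (n + 1) → ℝ)) (x : Fin (n + 1) → ℝ) :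
    Submodule ℝ (Fin (n + 1) → ℝ) :=
  Submodule.span ℝ {X | ∃ γ : ℝ → (Fin (n + 1) → ℝ),
    γ 0 = x ∧ (∀ᶠ t in 𝓝 0, γ t ∈ M) ∧ HasDerivAt γ X 0}

/-- `ξ` is (along `M`) the equiaffine normal field of the hypersurface `M` for the co-orientation
given by the vector field `κ`; `h` is the equiaffine metric, and `S` is the equiaffine shape
operator. The ambient volume form is the standard one (the determinant). -/
structure IsEquiaffine {n : ℕ} (M : Set (Fin (n + 1) → ℝ))
    (κ ξ : (Fin (n + 1) → ℝ) → (Fin (n + 1) → ℝ))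
    (h : ∀ x, LinearMap.BilinForm ℝ (tangent M x))
    (S : ∀ x, tangent M x →ₗ[ℝ] tangent M x) : Prop where
  hypersurface : IsSmoothHypersurface M
  /-- `ξ` is smooth in a neighbourhood of `M`. -/
  smooth : ∃ W, IsOpen W ∧ M ⊆ W ∧ ContDiffOn ℝ ∞ ξ W
  transverse : ∀ x ∈ M, ξ x ∉ tangent M x
  /-- `ξ` and `κ` point to the same side of `M`. -/
  cooriented : ∀ x ∈ M, ∃ c : ℝ, 0 < c ∧ ξ x - c • κ x ∈ tangent M x
  /-- Gauss formula `D_X Y = ∇_X Y + h(X, Y) ξ` with `∇_X Y` tangent to `M`, for `Y` a local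
  vector field tangent to `M`. -/
  gauss : ∀ x ∈ M, ∀ (X : tangent M x) (Y : (Fin (n + 1) → ℝ) → (Fin (n + 1) → ℝ)),
    ContDiffAt ℝ ∞ Y x → (∀ᶠ y in 𝓝[M] x, Y y ∈ tangent M y) → ∀ hY : Y x ∈ tangent M x,
      fderiv ℝ Y x X - h x X ⟨Y x, hY⟩ • ξ x ∈ tangent M x
  /-- Weingarten formula `D_X ξ = -S X + τ(X) ξ` with vanishing connection form `τ`. -/
  weingarten : ∀ x ∈ M, ∀ X : tangent M x, fderiv ℝ ξ x X = -(S x X : Fin (n + 1) → ℝ)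
  nondegenerate : ∀ x ∈ M, (h x).Nondegenerate
  /-- The volume density of `h` is the one induced by `ξ` and the determinant. -/
  volume : ∀ x ∈ M, ∀ X : Fin n → tangent M x,
    |(Matrix.of fun i j => h x (X i) (X j)).det| =
      (Matrix.of (Matrix.vecCons (ξ x) fun i => (X i : Fin (n + 1) → ℝ))).det ^ 2

/-- Number of positive minus number of negative eigenvalues of a symmetric bilinear form. -/
def signature {V : Type*} [AddCommGroup V] [Module ℝ V] (h : LinearMap.BilinForm ℝ V) : ℤ :=
  sigPos (LinearMap.BilinMap.toQuadraticMap h) -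
    sigNeg (LinearMap.BilinMap.toQuadraticMap h)

/-- The shape operator field `S` on `M` has constant mean curvature (normalized trace) `A`. -/
def HasMeanCurvature {n : ℕ} (M : Set (Fin (n + 1) → ℝ))
    (S : ∀ x, tangent M x →ₗ[ℝ] tangent M x) (A : ℝ) : Prop :=
  ∀ x ∈ M, LinearMap.trace ℝ (tangent M x) (S x) / n = A

/-- The co-oriented, possibly disconnected, nondegenerate hypersurface `M` has constant affine mean
curvature `A`. -/
def HasAffineMeanCurvature {n : ℕ} (M : Set (Fin (n + 1) → ℝ))
    (κ : (Fin (n + 1) → ℝ) → (Fin (n + 1) → ℝ)) (A : ℝ) : Prop :=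
  ∃ ξ h S, IsEquiaffine M κ ξ h S ∧ HasMeanCurvature M S A

/-- `M`, with the co-orientation of its components given by `κ`, is a (possibly disconnected) proper
affine sphere with centre `v`: it is nondegenerate, all equiaffine normal lines pass through `v`,
the affine mean curvature is the same nonzero constant on all components, and the signatures modulo
4 of the equiaffine metric are the same on all components. -/
def IsProperAffineSphere {n : ℕ} (M : Set (Fin (n + 1) → ℝ))
    (κ : (Fin (n + 1) → ℝ) → (Fin (n + 1) → ℝ)) (v : Fin (n + 1) → ℝ) : Prop :=
  ∃ ξ h S, IsEquiaffine M κ ξ h S ∧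
    (∀ x ∈ M, ∃ s : ℝ, v = x + s • ξ x) ∧
    (∃ A : ℝ, A ≠ 0 ∧ HasMeanCurvature M S A) ∧
    ∀ x ∈ M, ∀ y ∈ M, signature (h x) ≡ signature (h y) [ZMOD 4]

/-- `M`, with the co-orientation of its components given by `κ`, is a (possibly disconnected)
improper affine sphere whose equiaffine normal is `c v` for a constant `c` (the same on all
components). -/
def IsImproperAffineSphere {n : ℕ} (M : Set (Fin (n + 1) → ℝ))
    (κ : (Fin (n + 1) → ℝ) → (Fin (n + 1) → ℝ)) (v : Fin (n + 1) → ℝ) : Prop :=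
  ∃ ξ h S, IsEquiaffine M κ ξ h S ∧
    (∃ c : ℝ, ∀ x ∈ M, ξ x = c • v) ∧
    HasMeanCurvature M S 0 ∧
    ∀ x ∈ M, ∀ y ∈ M, signature (h x) ≡ signature (h y) [ZMOD 4]

end AffineSphere

end

/-!
Let `E` be the radial field, with flow `x ↦ e^t (x - v) + v` (`ε = 0`) or `x ↦ x + t v` (`ε = 1`).
Differentiating the homogeneity of `F` at `t = 0` gives Euler's identity `dF(E) = λ F + α`; as
`DE = (1 - ε) id`, differentiating once more gives `Hess F (E) = μ dF` with `μ = λ - (1 - ε) ≠ 0`.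
Hence `F^i = μ⁻¹ E` and `μ U(F) = (λ F + α) H(F)`, so `H(F)` and `U(F)` are simultaneously functions
of `F`.

Along the level set `L_r`, put `d = λ r + α`. A transverse field `k E` with `k` constant has shape
operator `-k (1 - ε) id` and induces on tangent vectors the metric `-(k d)⁻¹ Hess F`, and comparing
volumes shows that it is the equiaffine normal exactly when
`|H(F)| = |k| ^ (n + 2) |μ| |d| ^ (n + 1)`. Conversely, the equiaffine normal of an affine sphere is
such a multiple of `E`. So `L_r` is an affine sphere precisely when `H(F)` is constant on it; the
condition on the signatures modulo `4` is what fixes the sign of `H(F)`, because the signature of a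
nondegenerate form of rank `n` modulo `4` is determined by the sign of its discriminant.

Finally, `H(F)` is itself homogeneous under the flow, so the quotient of `φ` by the explicit weight
with the same homogeneity is locally constant.
-/

noncomputable section

namespace AffineSphere

section LinearAlgebra

open Matrix

theorem sum_sign_modEq_four {ι R : Type*} [CommRing R] [LinearOrder R] [IsStrictOrderedRing R]
    (s : Finset ι) {w : ι → R} (hw : ∀ i ∈ s, w i ≠ 0) :
    ∑ i ∈ s, (SignType.sign (w i) : ℤ) ≡
      s.card - 1 + (SignType.sign (∏ i ∈ s, w i) : ℤ) [ZMOD 4] := by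
  classical
  induction s using Finset.induction_on with
  | empty => simp
  | insert a s ha ih =>
    obtain ⟨hwa, hws⟩ := Finset.forall_mem_insert _ _ _ |>.1 hw
    rw [Finset.sum_insert ha, Finset.prod_insert ha, Finset.card_insert_of_notMem ha, sign_mul]
    have ih := ih hws
    rcases hwa.lt_or_gt with h₁ | h₁ <;>
      rcases (Finset.prod_ne_zero_iff.2 hws).lt_or_gt with h₂ | h₂ <;>
      simp only [h₁, h₂, sign_neg, sign_pos, Int.ModEq, SignType.coe_neg_one, SignType.coe_one,
        mul_one, mul_neg, neg_neg] at ih ⊢ <;> push_cast <;> omega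

theorem ncard_pos_sub_ncard_neg {ι R : Type*} [Fintype ι] [Zero R] [LinearOrder R] (w : ι → R) :
    ({i | 0 < w i}.ncard : ℤ) - {i | w i < 0}.ncard = ∑ i, (SignType.sign (w i) : ℤ) := by
  classical
  have ncard_eq (p : ι → Prop) : ({i | p i}.ncard : ℤ) = ∑ i, if p i then 1 else 0 := by
    rw [Set.ncard_eq_toFinset_card', Finset.sum_boole]
    simp
  rw [ncard_eq, ncard_eq, ← Finset.sum_sub_distrib]
  refine Finset.sum_congr rfl fun i _ => ?_
  rcases lt_trichotomy (w i) 0 with h | h | h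
  · simp [h, h.not_gt]
  · simp [h]
  · simp [h, h.not_gt]

theorem det_gram_eq_of_iIsOrtho {ι R V : Type*} [Fintype ι] [DecidableEq ι] [CommRing R]
    [AddCommGroup V] [Module R V] (b : Module.Basis ι R V) {c : Module.Basis ι R V}
    {B : LinearMap.BilinForm R V} (hc : B.iIsOrtho c) :
    (Matrix.of fun i j => B (b i) (b j)).det = (c.toMatrix b).det ^ 2 * ∏ i, B (c i) (c i) := by
  have hdiag : LinearMap.BilinForm.toMatrix c B = Matrix.diagonal fun i => B (c i) (c i) := by
    ext i j
    rw [LinearMap.BilinForm.toMatrix_apply, Matrix.diagonal_apply]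
    split_ifs with hij
    · rw [hij]
    · exact hc hij
  have hgram : (Matrix.of fun i j => B (b i) (b j)) = LinearMap.BilinForm.toMatrix b B := by
    ext i j
    rw [LinearMap.BilinForm.toMatrix_apply, Matrix.of_apply]
  rw [hgram, ← LinearMap.BilinForm.toMatrix_mul_basis_toMatrix c b B, hdiag, Matrix.det_mul,
    Matrix.det_mul, Matrix.det_transpose, Matrix.det_diagonal]
  ring

section Signature

variable {V W : Type*} [AddCommGroup V] [Module ℝ V] [AddCommGroup W] [Module ℝ W]
  {B : LinearMap.BilinForm ℝ V} {C : LinearMap.BilinForm ℝ W}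

theorem signature_eq_sum_sign {ι : Type*} [Fintype ι] {c : Module.Basis ι ℝ V}
    (hB : ∀ x y, B x y = B y x) (hc : B.iIsOrtho c) :
    signature B = ∑ i, (SignType.sign (B (c i) (c i)) : ℤ) := by
  let Q := LinearMap.BilinMap.toQuadraticMap B
  have hassoc : QuadraticMap.associated (R := ℝ) Q = B :=
    QuadraticMap.associated_left_inverse ℝ hB
  have hQ : QuadraticMap.Equivalent Q (QuadraticMap.weightedSumSquares ℝ fun i => B (c i) (c i)) :=
    ⟨QuadraticMap.basisRepr_eq_of_iIsOrtho Q c (by rwa [hassoc]) ▸ Q.isometryEquivBasisRepr c⟩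
  rw [signature, QuadraticForm.sigPos_of_equiv_weightedSumSquares hQ,
    QuadraticForm.sigNeg_of_equiv_weightedSumSquares hQ, ncard_pos_sub_ncard_neg]

theorem signature_modEq_four {n : ℕ} (b : Module.Basis (Fin n) ℝ V)
    (hB : ∀ x y, B x y = B y x) (hdet : (Matrix.of fun i j => B (b i) (b j)).det ≠ 0) :
    signature B ≡
      n - 1 + (SignType.sign (Matrix.of fun i j => B (b i) (b j)).det : ℤ) [ZMOD 4] := by
  have : FiniteDimensional ℝ V := b.finiteDimensional_of_finite
  obtain rfl : Module.finrank ℝ V = n := by rw [Module.finrank_eq_card_basis b, Fintype.card_fin]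
  obtain ⟨c, hc⟩ := LinearMap.BilinForm.exists_orthogonal_basis (B := B) ⟨hB⟩
  rw [det_gram_eq_of_iIsOrtho b hc] at hdet ⊢
  have hsq : 0 < (c.toMatrix b).det ^ 2 := pow_two_pos_of_ne_zero
    (pow_ne_zero_iff two_ne_zero |>.1 (left_ne_zero_of_mul hdet))
  rw [sign_mul, sign_pos hsq, one_mul, signature_eq_sum_sign hB hc]
  simpa only [Finset.card_univ, Fintype.card_fin] using
    sum_sign_modEq_four Finset.univ (Finset.prod_ne_zero_iff.1 (right_ne_zero_of_mul hdet))

theorem signature_modEq_signature_iff {n : ℕ} (b : Module.Basis (Fin n) ℝ V)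
    (c : Module.Basis (Fin n) ℝ W) (hB : ∀ x y, B x y = B y x) (hC : ∀ x y, C x y = C y x)
    (hBdet : (Matrix.of fun i j => B (b i) (b j)).det ≠ 0)
    (hCdet : (Matrix.of fun i j => C (c i) (c j)).det ≠ 0) :
    signature B ≡ signature C [ZMOD 4] ↔
      SignType.sign (Matrix.of fun i j => B (b i) (b j)).det =
        SignType.sign (Matrix.of fun i j => C (c i) (c j)).det := by
  have hsB := signature_modEq_four b hB hBdet
  have hsC := signature_modEq_four c hC hCdet
  rcases hBdet.lt_or_gt with h₁ | h₁ <;> rcases hCdet.lt_or_gt with h₂ | h₂ <;>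
    simp only [h₁, h₂, sign_neg, sign_pos, SignType.coe_neg_one, SignType.coe_one,
      Int.ModEq] at hsB hsC ⊢ <;> simp <;> omega

end Signature

theorem mul_dotProduct_adjugate_mulVec {m R : Type*} [Fintype m] [DecidableEq m] [CommRing R]
    {A : Matrix m m R} {μ : R} {e f : m → R} (h : A *ᵥ e = μ • f) :
    μ * (f ⬝ᵥ A.adjugate *ᵥ f) = (f ⬝ᵥ e) * A.det :=
  calc μ * (f ⬝ᵥ A.adjugate *ᵥ f) = f ⬝ᵥ A.adjugate *ᵥ (A *ᵥ e) := by
        rw [h, mulVec_smul, dotProduct_smul, smul_eq_mul]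
    _ = (f ⬝ᵥ e) * A.det := by
        rw [mulVec_mulVec, adjugate_mul, smul_mulVec, one_mulVec, dotProduct_smul, smul_eq_mul,
          mul_comm]

theorem inv_mulVec_eq_inv_smul {m K : Type*} [Fintype m] [DecidableEq m] [Field K]
    {A : Matrix m m K} {μ : K} {e f : m → K} (hA : A.det ≠ 0) (hμ : μ ≠ 0)
    (h : A *ᵥ e = μ • f) : A⁻¹ *ᵥ f = μ⁻¹ • e := by
  rw [eq_inv_smul_iff₀ hμ, ← mulVec_smul, ← h, mulVec_mulVec,
    nonsing_inv_mul _ (isUnit_iff_ne_zero.2 hA), one_mulVec]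

section VecCons

variable {R : Type*} [CommRing R] {n : ℕ}

theorem det_vecCons_smul (k : R) (e : Fin (n + 1) → R) (X : Fin n → Fin (n + 1) → R) :
    (Matrix.of (vecCons (k • e) X)).det = k * (Matrix.of (vecCons e X)).det := by
  have hupdate (w : Fin (n + 1) → R) :
      Matrix.of (vecCons w X) = (Matrix.of (vecCons e X)).updateRow 0 w := by
    ext i j
    refine Fin.cases ?_ (fun i => ?_) i <;> simp
  rw [hupdate, det_updateRow_smul, ← hupdate]

theorem mul_det_gram {A : Matrix (Fin (n + 1)) (Fin (n + 1)) R} {μ : R}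
    {e f : Fin (n + 1) → R} (h : A *ᵥ e = μ • f) {X : Fin n → Fin (n + 1) → R}
    (hX : ∀ i, f ⬝ᵥ X i = 0) :
    μ * (f ⬝ᵥ e) * (Matrix.of fun i j => X i ⬝ᵥ A *ᵥ X j).det =
      A.det * (Matrix.of (vecCons e X)).det ^ 2 := by
  let P := Matrix.of (vecCons e X)
  have entry (i j) : (P * A * Pᵀ) i j = P i ⬝ᵥ A *ᵥ P j := by
    rw [Matrix.mul_assoc, mul_apply']
    rfl
  have corner : (P * A * Pᵀ) 0 0 = μ * (f ⬝ᵥ e) := by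
    rw [entry]
    change e ⬝ᵥ A *ᵥ e = _
    rw [h, dotProduct_smul, smul_eq_mul, dotProduct_comm]
  have column (i : Fin n) : (P * A * Pᵀ) i.succ 0 = 0 := by
    rw [entry]
    change X i ⬝ᵥ A *ᵥ e = 0
    rw [h, dotProduct_smul, dotProduct_comm, hX, smul_zero]
  have minor : (P * A * Pᵀ).submatrix (Fin.succAbove 0) Fin.succ =
      Matrix.of fun i j => X i ⬝ᵥ A *ᵥ X j := by
    ext i j
    exact entry _ _
  calc μ * (f ⬝ᵥ e) * (Matrix.of fun i j => X i ⬝ᵥ A *ᵥ X j).det = (P * A * Pᵀ).det := by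
        rw [det_succ_column_zero, Fin.sum_univ_succ, Finset.sum_eq_zero fun i _ => by
          rw [column, mul_zero, zero_mul], corner, minor]
        simp
    _ = A.det * P.det ^ 2 := by
        rw [det_mul, det_mul, det_transpose]
        ring

end VecCons

theorem det_vecCons_ne_zero {K : Type*} [Field K] {n : ℕ} {T : Submodule K (Fin (n + 1) → K)}
    (b : Module.Basis (Fin n) K T) {e : Fin (n + 1) → K} (he : e ∉ T) :
    (Matrix.of (vecCons e fun i => (b i : Fin (n + 1) → K))).det ≠ 0 := by
  have hspan : Submodule.span K (Set.range fun i => (b i : Fin (n + 1) → K)) ≤ T :=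
    Submodule.span_le.2 (by rintro _ ⟨i, rfl⟩; exact (b i).2)
  have hindep := linearIndependent_finCons.2
    ⟨b.linearIndependent.map' T.subtype T.ker_subtype, fun h => he (hspan h)⟩
  exact ((isUnit_iff_isUnit_det _).1 (linearIndependent_rows_iff_isUnit.1 hindep)).ne_zero

end LinearAlgebra

section Calculus

variable {n : ℕ}

theorem diff_dotProduct (F : (Fin (n + 1) → ℝ) → ℝ) (x X : Fin (n + 1) → ℝ) :
    diff F x ⬝ᵥ X = fderiv ℝ F x X := by
  conv_rhs => rw [pi_eq_sum_univ' X, map_sum]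
  simp only [dotProduct, diff, map_smul, smul_eq_mul, mul_comm]

theorem hess_mulVec_apply (F : (Fin (n + 1) → ℝ) → ℝ) (x Y : Fin (n + 1) → ℝ) (i : Fin (n + 1)) :
    (hess F x).mulVec Y i = fderiv ℝ (fderiv ℝ F) x (Pi.single i 1) Y := by
  conv_rhs => rw [pi_eq_sum_univ' Y, map_sum]
  simp only [Matrix.mulVec, dotProduct, hess, Matrix.of_apply, map_smul, smul_eq_mul, mul_comm]

theorem dotProduct_hess_mulVec (F : (Fin (n + 1) → ℝ) → ℝ) (x X Y : Fin (n + 1) → ℝ) :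
    X ⬝ᵥ (hess F x).mulVec Y = fderiv ℝ (fderiv ℝ F) x X Y := by
  conv_rhs => rw [pi_eq_sum_univ' X, map_sum, sum_apply]
  simp only [dotProduct, hess_mulVec_apply, map_smul, smul_apply, smul_eq_mul]

theorem hess_congr {F G : (Fin (n + 1) → ℝ) → ℝ} {x : Fin (n + 1) → ℝ} (h : F =ᶠ[𝓝 x] G) :
    hess F x = hess G x := by
  ext i j
  simp only [hess, Matrix.of_apply, h.fderiv.fderiv_eq]

theorem hess_comp_smul_add (F : (Fin (n + 1) → ℝ) → ℝ) (a : ℝ) (b x : Fin (n + 1) → ℝ) :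
    hess (fun y => F (a • y + b)) x = a ^ 2 • hess F (a • x + b) := by
  have hfderiv : fderiv ℝ (fun y => F (a • y + b)) = a • fun y => fderiv ℝ F (a • y + b) := by
    funext y
    rw [fderiv_comp_smul (f := fun z => F (z + b)), fderiv_comp_add_right]
    rfl
  ext i j
  simp only [hess, hfderiv, Matrix.of_apply, Matrix.smul_apply]
  rw [fderiv_const_smul_field (f := fun y => fderiv ℝ F (a • y + b)), Pi.smul_apply,
    fderiv_comp_smul (f := fun z => fderiv ℝ F (z + b)), fderiv_comp_add_right, smul_smul,
    ← pow_two]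
  rfl

theorem hess_const_mul_add_const (F : (Fin (n + 1) → ℝ) → ℝ) (c b : ℝ) (x : Fin (n + 1) → ℝ) :
    hess (fun y => c * F y + b) x = c • hess F x := by
  have hfderiv : fderiv ℝ (fun y => c * F y + b) = c • fderiv ℝ F := by
    funext y
    rw [fderiv_add_const, ← fderiv_const_smul_field]
    rfl
  ext i j
  simp only [hess, hfderiv, Matrix.of_apply, Matrix.smul_apply]
  rw [fderiv_const_smul_field (f := fderiv ℝ F)]
  rfl

/-- The Hessian of `F` at `x` as a bilinear form, for restriction to tangent spaces. -/
def hessForm (F : (Fin (n + 1) → ℝ) → ℝ) (x : Fin (n + 1) → ℝ) :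
    LinearMap.BilinForm ℝ (Fin (n + 1) → ℝ) :=
  ContinuousLinearMap.coeLM ℝ ∘ₗ (fderiv ℝ (fderiv ℝ F) x).toLinearMap

end Calculus

section LevelSet

variable {n : ℕ} {Ω M : Set (Fin (n + 1) → ℝ)} {F : (Fin (n + 1) → ℝ) → ℝ}
  {x : Fin (n + 1) → ℝ} {r : ℝ}

theorem fderiv_apply_eq_zero_of_eventually {E : Type*} [NormedAddCommGroup E] [NormedSpace ℝ E]
    {g : (Fin (n + 1) → ℝ) → E} (hg : DifferentiableAt ℝ g x) (h0 : ∀ᶠ y in 𝓝[M] x, g y = 0)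
    {X : Fin (n + 1) → ℝ} (hX : X ∈ tangent M x) : fderiv ℝ g x X = 0 := by
  suffices h : tangent M x ≤ LinearMap.ker (fderiv ℝ g x).toLinearMap from h hX
  refine Submodule.span_le.2 ?_
  rintro X ⟨γ, rfl, hγM, hγ⟩
  have htend : Filter.Tendsto γ (𝓝 0) (𝓝[M] (γ 0)) :=
    tendsto_nhdsWithin_iff.2 ⟨hγ.continuousAt, hγM⟩
  have hzero : g ∘ γ =ᶠ[𝓝 0] fun _ => 0 := htend.eventually h0
  exact (hg.hasFDerivAt.comp_hasDerivAt (0 : ℝ) hγ).unique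
    ((hasDerivAt_const (0 : ℝ) (0 : E)).congr_of_eventuallyEq hzero)

theorem mem_tangent_of_fderiv_eq_zero (hM : ∀ᶠ y in 𝓝 x, F y = F x → y ∈ M)
    (hF : HasStrictFDerivAt F (fderiv ℝ F x) x) (hdF : fderiv ℝ F x ≠ 0) {X : Fin (n + 1) → ℝ}
    (hX : fderiv ℝ F x X = 0) : X ∈ tangent M x := by
  have hsurj : (fderiv ℝ F x).range = ⊤ := LinearMap.range_eq_top.2 <|
    LinearMap.surjective fun h => hdF (by ext1 y; exact DFunLike.congr_fun h y)
  let X' : (fderiv ℝ F x).ker := ⟨X, hX⟩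
  let γ : ℝ → Fin (n + 1) → ℝ := fun t => hF.implicitFunction F _ hsurj (F x) (t • X')
  have hline : Filter.Tendsto (fun t : ℝ => t • X') (𝓝 0) (𝓝 0) := by
    have : Continuous fun t : ℝ => t • X' := by fun_prop
    simpa only [zero_smul] using this.tendsto 0
  have hγ : HasDerivAt γ X 0 := by
    have himplicit := (hF.to_implicitFunction hsurj).hasFDerivAt
    have hderiv : HasDerivAt (fun t : ℝ => t • X') X' 0 := by
      simpa using (hasDerivAt_id (0 : ℝ)).smul_const X'
    rw [← zero_smul ℝ X'] at himplicit
    exact himplicit.comp_hasDerivAt (0 : ℝ) hderiv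
  have hγlevel : ∀ᶠ t in 𝓝 0, F (γ t) = F x :=
    (tendsto_const_nhds.prodMk_nhds hline).eventually (hF.map_implicitFunction_eq hsurj)
  have hγ0 : γ 0 = x := by simp [γ]
  have hγM : ∀ᶠ t in 𝓝 0, F (γ t) = F x → γ t ∈ M :=
    hγ.continuousAt.eventually (by rwa [hγ0])
  exact Submodule.subset_span ⟨γ, hγ0, hγM.mp (hγlevel.mono fun t ht h => h ht), hγ⟩

/-- The level set `L_r` of `F` in `Ω`. An abbreviation, so that it unifies with the set-builder
form. -/
abbrev levelSet (Ω : Set (Fin (n + 1) → ℝ)) (F : (Fin (n + 1) → ℝ) → ℝ) (r : ℝ) :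
    Set (Fin (n + 1) → ℝ) :=
  {x ∈ Ω | F x = r}

theorem levelSet_inter_preimage {I : Set ℝ} (hr : r ∈ I) :
    levelSet (Ω ∩ F ⁻¹' I) F r = levelSet Ω F r := by
  ext x
  constructor
  · rintro ⟨⟨hx, -⟩, rfl⟩
    exact ⟨hx, rfl⟩
  · rintro ⟨hx, rfl⟩
    exact ⟨⟨hx, hr⟩, rfl⟩

theorem exists_comp_eq_iff {V K : Type*} [Zero K] {Ω : Set V} {F H : V → K} {I : Set K} :
    (∃ φ : K → K, (∀ r ∈ I, φ r ≠ 0) ∧ ∀ x ∈ Ω ∩ F ⁻¹' I, H x = φ (F x)) ↔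
      ∀ r ∈ I, ∃ p, p ≠ 0 ∧ ∀ x ∈ {x ∈ Ω | F x = r}, H x = p := by
  constructor
  · rintro ⟨φ, hφ0, hφ⟩ r hr
    refine ⟨φ r, hφ0 r hr, ?_⟩
    rintro x ⟨hx, rfl⟩
    exact hφ x ⟨hx, hr⟩
  · intro h
    choose! φ hφ0 hφ using h
    exact ⟨φ, hφ0, fun x hx => hφ _ hx.2 x ⟨hx.1, rfl⟩⟩

/-- `F` is a smooth submersion on the open set `Ω`, so that its level sets in `Ω` are smooth
hypersurfaces. -/
structure IsRegularOn (F : (Fin (n + 1) → ℝ) → ℝ) (Ω : Set (Fin (n + 1) → ℝ)) : Prop where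
  isOpen : IsOpen Ω
  contDiffOn : ContDiffOn ℝ ∞ F Ω
  fderiv_ne_zero : ∀ x ∈ Ω, fderiv ℝ F x ≠ 0

namespace IsRegularOn

theorem contDiffAt (hF : IsRegularOn F Ω) (hx : x ∈ Ω) : ContDiffAt ℝ ∞ F x :=
  hF.contDiffOn.contDiffAt (hF.isOpen.mem_nhds hx)

theorem differentiableAt (hF : IsRegularOn F Ω) (hx : x ∈ Ω) : DifferentiableAt ℝ F x :=
  (hF.contDiffAt hx).differentiableAt (by simp)

theorem contDiffAt_fderiv (hF : IsRegularOn F Ω) (hx : x ∈ Ω) : ContDiffAt ℝ ∞ (fderiv ℝ F) x :=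
  (hF.contDiffAt hx).fderiv_right (by simp)

theorem differentiableAt_fderiv (hF : IsRegularOn F Ω) (hx : x ∈ Ω) :
    DifferentiableAt ℝ (fderiv ℝ F) x :=
  (hF.contDiffAt_fderiv hx).differentiableAt (by simp)

theorem fderiv_fderiv_comm (hF : IsRegularOn F Ω) (hx : x ∈ Ω) (X Y : Fin (n + 1) → ℝ) :
    fderiv ℝ (fderiv ℝ F) x X Y = fderiv ℝ (fderiv ℝ F) x Y X :=
  (hF.contDiffAt hx).isSymmSndFDerivAt
    (by rw [minSmoothness_of_isRCLikeNormedField]; exact ENat.LEInfty.out) X Y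

theorem mem_tangent_iff (hF : IsRegularOn F Ω) (hx : x ∈ levelSet Ω F r) {X : Fin (n + 1) → ℝ} :
    X ∈ tangent (levelSet Ω F r) x ↔ fderiv ℝ F x X = 0 := by
  obtain ⟨hxΩ, rfl⟩ := hx
  constructor
  · intro hX
    rw [← fderiv_sub_const (F x)]
    exact fderiv_apply_eq_zero_of_eventually ((hF.differentiableAt hxΩ).sub_const _)
      (eventually_nhdsWithin_of_forall fun y hy => sub_eq_zero.2 hy.2) hX
  · exact mem_tangent_of_fderiv_eq_zero (M := levelSet Ω F (F x))
      ((hF.isOpen.eventually_mem hxΩ).mono fun y hy hFy => ⟨hy, hFy⟩)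
      ((hF.contDiffAt hxΩ).hasStrictFDerivAt (by simp)) (hF.fderiv_ne_zero x hxΩ)

theorem isSmoothHypersurface (hF : IsRegularOn F Ω) : IsSmoothHypersurface (levelSet Ω F r) := by
  refine fun x hx => ⟨Ω, fun y => F y - r, hF.isOpen, hx.1, hF.contDiffOn.sub contDiffOn_const,
    fun y hy => ?_, ?_⟩
  · rw [fderiv_sub_const]
    exact hF.fderiv_ne_zero y hy
  · ext y
    simp only [Set.mem_inter_iff, Set.mem_ofPred_eq, sub_eq_zero]
    tauto

theorem finrank_tangent (hF : IsRegularOn F Ω) (hx : x ∈ levelSet Ω F r) :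
    Module.finrank ℝ (tangent (levelSet Ω F r) x) = n := by
  have hker : tangent (levelSet Ω F r) x = LinearMap.ker (fderiv ℝ F x).toLinearMap := by
    ext X
    exact hF.mem_tangent_iff hx
  have hrank := Module.Dual.finrank_ker_add_one_of_ne_zero (f := (fderiv ℝ F x).toLinearMap)
    fun h => hF.fderiv_ne_zero x hx.1 (by ext1 y; exact DFunLike.congr_fun h y)
  rw [Module.finrank_fin_fun] at hrank
  rw [hker]
  omega

theorem fderiv_fderiv_add_fderiv_eq_zero (hF : IsRegularOn F Ω) (hx : x ∈ levelSet Ω F r)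
    {X : Fin (n + 1) → ℝ} (hX : X ∈ tangent (levelSet Ω F r) x)
    {Y : (Fin (n + 1) → ℝ) → (Fin (n + 1) → ℝ)} (hY : DifferentiableAt ℝ Y x)
    (hYt : ∀ᶠ y in 𝓝[levelSet Ω F r] x, Y y ∈ tangent (levelSet Ω F r) y) :
    fderiv ℝ (fderiv ℝ F) x X (Y x) + fderiv ℝ F x (fderiv ℝ Y x X) = 0 := by
  have hderiv := (hF.differentiableAt_fderiv hx.1).hasFDerivAt.clm_apply hY.hasFDerivAt
  have hzero : ∀ᶠ y in 𝓝[levelSet Ω F r] x, fderiv ℝ F y (Y y) = 0 := by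
    filter_upwards [hYt, self_mem_nhdsWithin] with y hy hyL
    exact (hF.mem_tangent_iff hyL).1 hy
  have h := fderiv_apply_eq_zero_of_eventually hderiv.differentiableAt hzero hX
  rw [hderiv.fderiv] at h
  simpa [add_comm] using h

theorem fderiv_sub_smul_mem_tangent_iff (hF : IsRegularOn F Ω) (hx : x ∈ levelSet Ω F r)
    {X : Fin (n + 1) → ℝ} (hX : X ∈ tangent (levelSet Ω F r) x)
    {Y : (Fin (n + 1) → ℝ) → (Fin (n + 1) → ℝ)} (hY : DifferentiableAt ℝ Y x)
    (hYt : ∀ᶠ y in 𝓝[levelSet Ω F r] x, Y y ∈ tangent (levelSet Ω F r) y)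
    {a : ℝ} {ξ : Fin (n + 1) → ℝ} :
    fderiv ℝ Y x X - a • ξ ∈ tangent (levelSet Ω F r) x ↔
      -fderiv ℝ F x ξ * a = fderiv ℝ (fderiv ℝ F) x X (Y x) := by
  have h := hF.fderiv_fderiv_add_fderiv_eq_zero hx hX hY hYt
  rw [hF.mem_tangent_iff hx, map_sub, map_smul, smul_eq_mul]
  exact ⟨fun h' => by linear_combination h' - h, fun h' => by linear_combination h' + h⟩

theorem exists_tangent_extension (hF : IsRegularOn F Ω) (hx : x ∈ levelSet Ω F r)
    {Z : Fin (n + 1) → ℝ} (hZ : Z ∈ tangent (levelSet Ω F r) x) :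
    ∃ Y : (Fin (n + 1) → ℝ) → (Fin (n + 1) → ℝ), ContDiffAt ℝ ∞ Y x ∧ Y x = Z ∧
      ∀ᶠ y in 𝓝[levelSet Ω F r] x, Y y ∈ tangent (levelSet Ω F r) y := by
  obtain ⟨N, hN⟩ : ∃ N, fderiv ℝ F x N ≠ 0 := by
    by_contra! h
    exact hF.fderiv_ne_zero x hx.1 (ContinuousLinearMap.ext h)
  have hd := hF.contDiffAt_fderiv hx.1
  have hdN : ContDiffAt ℝ ∞ (fun y => fderiv ℝ F y N) x := hd.clm_apply contDiffAt_const
  refine ⟨fun y => Z - (fderiv ℝ F y Z / fderiv ℝ F y N) • N, ?_, ?_, ?_⟩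
  · exact contDiffAt_const.sub
      (((hd.clm_apply contDiffAt_const).div hdN hN).smul contDiffAt_const)
  · simp [(hF.mem_tangent_iff hx).1 hZ]
  · filter_upwards [self_mem_nhdsWithin,
      (hdN.continuousAt.eventually_ne hN).filter_mono nhdsWithin_le_nhds] with y hy hNy
    rw [hF.mem_tangent_iff hy, map_sub, map_smul, smul_eq_mul, div_mul_cancel₀ _ hNy, sub_self]

theorem metric_eq (hF : IsRegularOn F Ω) {κ ξ : (Fin (n + 1) → ℝ) → (Fin (n + 1) → ℝ)}
    {h : ∀ x, LinearMap.BilinForm ℝ (tangent (levelSet Ω F r) x)}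
    {S : ∀ x, tangent (levelSet Ω F r) x →ₗ[ℝ] tangent (levelSet Ω F r) x}
    (hM : IsEquiaffine (levelSet Ω F r) κ ξ h S) (hx : x ∈ levelSet Ω F r)
    (X Y : tangent (levelSet Ω F r) x) :
    -fderiv ℝ F x (ξ x) * h x X Y = fderiv ℝ (fderiv ℝ F) x X Y := by
  obtain ⟨Z, hZ, hZx, hZt⟩ := hF.exists_tangent_extension hx Y.2
  have hgauss := hM.gauss x hx X Z hZ hZt (hZx ▸ Y.2)
  rw [hF.fderiv_sub_smul_mem_tangent_iff hx X.2 (hZ.differentiableAt (by simp)) hZt] at hgauss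
  simpa only [hZx] using hgauss

end IsRegularOn

end LevelSet

section Euler

variable {n : ℕ} {lam ε α r k c : ℝ} {Ω : Set (Fin (n + 1) → ℝ)} {v x y : Fin (n + 1) → ℝ}
  {F : (Fin (n + 1) → ℝ) → ℝ}

/-- The generator `(1 - ε)(x - v) + ε v` of the flow under which `F` is affinely homogeneous. -/
def radial (ε : ℝ) (v x : Fin (n + 1) → ℝ) : Fin (n + 1) → ℝ :=
  (1 - ε) • (x - v) + ε • v

theorem radial_zero (v x : Fin (n + 1) → ℝ) : radial 0 v x = x - v := by
  simp [radial]

theorem radial_one (v x : Fin (n + 1) → ℝ) : radial 1 v x = v := by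
  simp [radial]

theorem hasFDerivAt_radial (ε : ℝ) (v x : Fin (n + 1) → ℝ) :
    HasFDerivAt (radial ε v) ((1 - ε) • ContinuousLinearMap.id ℝ (Fin (n + 1) → ℝ)) x :=
  (((hasFDerivAt_id x).sub_const v).const_smul (1 - ε)).add_const (ε • v)

theorem contDiff_radial (ε : ℝ) (v : Fin (n + 1) → ℝ) : ContDiff ℝ ∞ (radial ε v) := by
  unfold radial
  fun_prop

/-- `F` is smooth on the open set `Ω` and satisfies there Euler's identity `dF(E) = λ F + α` for
the radial field `E`, with nonvanishing right-hand side. This is the infinitesimal form of affine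
homogeneity. -/
structure IsEulerRegularOn (lam ε α : ℝ) (Ω : Set (Fin (n + 1) → ℝ)) (v : Fin (n + 1) → ℝ)
    (F : (Fin (n + 1) → ℝ) → ℝ) : Prop where
  isOpen : IsOpen Ω
  contDiffOn : ContDiffOn ℝ ∞ F Ω
  euler : ∀ x ∈ Ω, fderiv ℝ F x (radial ε v x) = lam * F x + α
  mul_add_ne_zero : ∀ x ∈ Ω, lam * F x + α ≠ 0

namespace IsEulerRegularOn

theorem isRegularOn (hF : IsEulerRegularOn lam ε α Ω v F) : IsRegularOn F Ω where
  isOpen := hF.isOpen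
  contDiffOn := hF.contDiffOn
  fderiv_ne_zero x hx h := hF.mul_add_ne_zero x hx (by rw [← hF.euler x hx, h]; rfl)

theorem hess_radial (hF : IsEulerRegularOn lam ε α Ω v F) (hx : x ∈ Ω) (X : Fin (n + 1) → ℝ) :
    fderiv ℝ (fderiv ℝ F) x X (radial ε v x) = (lam - (1 - ε)) * fderiv ℝ F x X := by
  have hleft := (hF.isRegularOn.differentiableAt_fderiv hx).hasFDerivAt.clm_apply
    (hasFDerivAt_radial ε v x)
  have hright : HasFDerivAt (fun y => lam * F y + α) (lam • fderiv ℝ F x) x :=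
    ((hF.isRegularOn.differentiableAt hx).hasFDerivAt.const_mul lam).add_const α
  have heuler : (fun y => fderiv ℝ F y (radial ε v y)) =ᶠ[𝓝 x] fun y => lam * F y + α :=
    (hF.isOpen.eventually_mem hx).mono hF.euler
  have h := DFunLike.congr_fun (hleft.unique (hright.congr_of_eventuallyEq heuler)) X
  simp only [add_apply, ContinuousLinearMap.comp_apply, ContinuousLinearMap.flip_apply, smul_apply,
    ContinuousLinearMap.id_apply, map_smul, smul_eq_mul] at h
  linear_combination h

theorem hess_mulVec_radial (hF : IsEulerRegularOn lam ε α Ω v F) (hx : x ∈ Ω) :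
    (hess F x).mulVec (radial ε v x) = (lam - (1 - ε)) • diff F x := by
  ext i
  rw [hess_mulVec_apply, hF.hess_radial hx]
  rfl

theorem diff_dotProduct_radial (hF : IsEulerRegularOn lam ε α Ω v F) (hx : x ∈ Ω) :
    diff F x ⬝ᵥ radial ε v x = lam * F x + α := by
  rw [diff_dotProduct, hF.euler x hx]

theorem mul_adjQuad (hF : IsEulerRegularOn lam ε α Ω v F) (hx : x ∈ Ω) :
    (lam - (1 - ε)) * adjQuad F x = (lam * F x + α) * hessDet F x := by
  rw [← hF.diff_dotProduct_radial hx]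
  exact mul_dotProduct_adjugate_mulVec (hF.hess_mulVec_radial hx)

theorem hessGrad_eq (hF : IsEulerRegularOn lam ε α Ω v F) (hx : x ∈ Ω)
    (hμ : lam - (1 - ε) ≠ 0) (hH : hessDet F x ≠ 0) :
    hessGrad F x = (lam - (1 - ε))⁻¹ • radial ε v x :=
  inv_mulVec_eq_inv_smul hH hμ (hF.hess_mulVec_radial hx)

theorem exists_smul_radial_eq_smul_stdCoorient (hF : IsEulerRegularOn lam ε α Ω v F) (hx : x ∈ Ω)
    (hμ : lam - (1 - ε) ≠ 0) (hH : hessDet F x ≠ 0) (hk : k * (lam * F x + α) < 0) :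
    ∃ c : ℝ, 0 < c ∧ k • radial ε v x = c • stdCoorient F x := by
  have hadj := hF.mul_adjQuad hx
  have hU : adjQuad F x ≠ 0 := right_ne_zero_of_mul
    (hadj.trans_ne (mul_ne_zero (hF.mul_add_ne_zero x hx) hH))
  have hUH : adjQuad F x * hessDet F x ≠ 0 := mul_ne_zero hU hH
  let s := Real.sign (adjQuad F x * hessDet F x)
  have hs : s * s = 1 := by
    rcases Real.sign_apply_eq_of_ne_zero _ hUH with h | h <;> simp only [s, h] <;> norm_num
  refine ⟨-(k * (lam - (1 - ε)) * s), ?_, ?_⟩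
  · have hpos : 0 < -(k * (lam - (1 - ε)) * s) * (s * (adjQuad F x * hessDet F x)) := by
      have : 0 < -(k * (lam * F x + α)) * hessDet F x ^ 2 :=
        mul_pos (neg_pos.2 hk) (pow_two_pos_of_ne_zero hH)
      linear_combination this + (k * hessDet F x) * hadj +
        (k * (lam - (1 - ε)) * (adjQuad F x * hessDet F x)) * hs
    exact pos_of_mul_pos_left hpos (Real.sign_mul_pos_of_ne_zero _ hUH).le
  · rw [stdCoorient, hF.hessGrad_eq hx hμ hH, smul_smul, smul_smul]
    congr 1
    change k = -(k * (lam - (1 - ε)) * s) * -s * (lam - (1 - ε))⁻¹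
    field_simp
    linear_combination -k * hs

theorem fderiv_radial (hF : IsEulerRegularOn lam ε α Ω v F) (hx : x ∈ levelSet Ω F r) :
    fderiv ℝ F x (radial ε v x) = lam * r + α := by
  rw [hF.euler x hx.1, hx.2]

theorem mul_add_level_ne_zero (hF : IsEulerRegularOn lam ε α Ω v F) (hx : x ∈ levelSet Ω F r) :
    lam * r + α ≠ 0 := by
  rw [← hx.2]
  exact hF.mul_add_ne_zero x hx.1

theorem radial_notMem_tangent (hF : IsEulerRegularOn lam ε α Ω v F) (hx : x ∈ levelSet Ω F r) :
    radial ε v x ∉ tangent (levelSet Ω F r) x := by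
  rw [hF.isRegularOn.mem_tangent_iff hx, hF.fderiv_radial hx]
  exact hF.mul_add_level_ne_zero hx

section Metric

variable {h : LinearMap.BilinForm ℝ (tangent (levelSet Ω F r) x)}
  {g : LinearMap.BilinForm ℝ (tangent (levelSet Ω F r) y)}

theorem det_metric (hF : IsEulerRegularOn lam ε α Ω v F) (hx : x ∈ levelSet Ω F r)
    (hh : ∀ X Y, c * h X Y = fderiv ℝ (fderiv ℝ F) x X Y)
    (X : Fin n → tangent (levelSet Ω F r) x) :
    c ^ n * ((lam - (1 - ε)) * (lam * r + α)) * (Matrix.of fun i j => h (X i) (X j)).det =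
      hessDet F x *
        (Matrix.of (Matrix.vecCons (radial ε v x) fun i => (X i : Fin (n + 1) → ℝ))).det ^ 2 := by
  have htangent (i) : diff F x ⬝ᵥ (X i : Fin (n + 1) → ℝ) = 0 := by
    rw [diff_dotProduct]
    exact (hF.isRegularOn.mem_tangent_iff hx).1 (X i).2
  have hgram : (Matrix.of fun i j => (X i : Fin (n + 1) → ℝ) ⬝ᵥ (hess F x).mulVec (X j)) =
      c • Matrix.of fun i j => h (X i) (X j) := by
    ext i j
    rw [Matrix.of_apply, dotProduct_hess_mulVec, ← hh]
    rfl
  have h := mul_det_gram (hF.hess_mulVec_radial hx.1) htangent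
  rw [hgram, Matrix.det_smul, Fintype.card_fin, diff_dotProduct, hF.fderiv_radial hx] at h
  rw [hessDet, ← h]
  ring

theorem det_metric_ne_zero (hF : IsEulerRegularOn lam ε α Ω v F) (hx : x ∈ levelSet Ω F r)
    (hh : ∀ X Y, c * h X Y = fderiv ℝ (fderiv ℝ F) x X Y) (hH : hessDet F x ≠ 0)
    (b : Module.Basis (Fin n) ℝ (tangent (levelSet Ω F r) x)) :
    (Matrix.of fun i j => h (b i) (b j)).det ≠ 0 := by
  refine right_ne_zero_of_mul ((hF.det_metric hx hh b).trans_ne (mul_ne_zero hH ?_))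
  exact pow_ne_zero 2 (det_vecCons_ne_zero b (hF.radial_notMem_tangent hx))

theorem abs_det_metric_eq_det_sq_iff (hF : IsEulerRegularOn lam ε α Ω v F)
    (hx : x ∈ levelSet Ω F r) (hμ : lam - (1 - ε) ≠ 0) (hk : k ≠ 0)
    (hh : ∀ X Y, -(k * (lam * r + α)) * h X Y = fderiv ℝ (fderiv ℝ F) x X Y)
    (X : Fin n → tangent (levelSet Ω F r) x) :
    |(Matrix.of fun i j => h (X i) (X j)).det| =
        (Matrix.of (Matrix.vecCons (k • radial ε v x) fun i => (X i : Fin (n + 1) → ℝ))).det ^ 2 ↔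
      |hessDet F x| *
          (Matrix.of (Matrix.vecCons (radial ε v x) fun i => (X i : Fin (n + 1) → ℝ))).det ^ 2 =
        |k| ^ (n + 2) * |lam - (1 - ε)| * |lam * r + α| ^ (n + 1) *
          (Matrix.of (Matrix.vecCons (radial ε v x) fun i => (X i : Fin (n + 1) → ℝ))).det ^ 2 := by
  rw [det_vecCons_smul]
  let D := (Matrix.of (Matrix.vecCons (radial ε v x) fun i => (X i : Fin (n + 1) → ℝ))).det
  let C := (-(k * (lam * r + α))) ^ n * ((lam - (1 - ε)) * (lam * r + α))
  have hC : |C| ≠ 0 := by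
    have := hF.mul_add_level_ne_zero hx
    simp only [C, ne_eq, abs_eq_zero, mul_eq_zero, pow_eq_zero_iff', neg_eq_zero]
    tauto
  have hgram : |C| * |(Matrix.of fun i j => h (X i) (X j)).det| = |hessDet F x| * D ^ 2 := by
    rw [← abs_sq D, ← abs_mul, ← abs_mul, hF.det_metric hx hh X]
  have hscale : |C| * (k * D) ^ 2 =
      |k| ^ (n + 2) * |lam - (1 - ε)| * |lam * r + α| ^ (n + 1) * D ^ 2 := by
    rw [abs_mul, abs_mul, abs_pow, abs_neg, abs_mul, mul_pow k, ← sq_abs k]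
    ring
  rw [← hgram, ← hscale]
  exact (mul_right_inj' hC).symm

theorem metric_comm (hF : IsEulerRegularOn lam ε α Ω v F) (hx : x ∈ levelSet Ω F r) (hc : c ≠ 0)
    (hh : ∀ X Y, c * h X Y = fderiv ℝ (fderiv ℝ F) x X Y)
    (X Y : tangent (levelSet Ω F r) x) : h X Y = h Y X :=
  mul_left_cancel₀ hc (by rw [hh, hh, hF.isRegularOn.fderiv_fderiv_comm hx.1])

theorem sign_mul_sign_det_metric (hF : IsEulerRegularOn lam ε α Ω v F) (hx : x ∈ levelSet Ω F r)
    (hh : ∀ X Y, c * h X Y = fderiv ℝ (fderiv ℝ F) x X Y)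
    (b : Module.Basis (Fin n) ℝ (tangent (levelSet Ω F r) x)) :
    SignType.sign (c ^ n * ((lam - (1 - ε)) * (lam * r + α))) *
      SignType.sign (Matrix.of fun i j => h (b i) (b j)).det = SignType.sign (hessDet F x) := by
  have hD := det_vecCons_ne_zero b (hF.radial_notMem_tangent hx)
  rw [← sign_mul, hF.det_metric hx hh, sign_mul, sign_pos (pow_two_pos_of_ne_zero hD), mul_one]

theorem signature_modEq_signature_iff_sign_hessDet (hF : IsEulerRegularOn lam ε α Ω v F)
    (hx : x ∈ levelSet Ω F r) (hy : y ∈ levelSet Ω F r) (hμ : lam - (1 - ε) ≠ 0) (hc : c ≠ 0)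
    (hh : ∀ X Y, c * h X Y = fderiv ℝ (fderiv ℝ F) x X Y)
    (hg : ∀ X Y, c * g X Y = fderiv ℝ (fderiv ℝ F) y X Y)
    (hHx : hessDet F x ≠ 0) (hHy : hessDet F y ≠ 0) :
    signature h ≡ signature g [ZMOD 4] ↔
      SignType.sign (hessDet F x) = SignType.sign (hessDet F y) := by
  have hC : c ^ n * ((lam - (1 - ε)) * (lam * r + α)) ≠ 0 :=
    mul_ne_zero (pow_ne_zero _ hc) (mul_ne_zero hμ (hF.mul_add_level_ne_zero hx))
  let b := Module.finBasisOfFinrankEq ℝ _ (hF.isRegularOn.finrank_tangent hx)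
  let b' := Module.finBasisOfFinrankEq ℝ _ (hF.isRegularOn.finrank_tangent hy)
  rw [signature_modEq_signature_iff b b' (hF.metric_comm hx hc hh) (hF.metric_comm hy hc hg)
    (hF.det_metric_ne_zero hx hh hHx b) (hF.det_metric_ne_zero hy hg hHy b'),
    ← hF.sign_mul_sign_det_metric hx hh b, ← hF.sign_mul_sign_det_metric hy hg b',
    mul_right_inj' (sign_ne_zero.2 hC)]

end Metric

end IsEulerRegularOn

end Euler

section AffineNormal

variable {n : ℕ} {lam ε α r k d : ℝ} {Ω : Set (Fin (n + 1) → ℝ)} {v x y : Fin (n + 1) → ℝ}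
  {F : (Fin (n + 1) → ℝ) → ℝ}

/-- The metric induced by the transverse field `k E` on a level set `M` of `F` along which
`dF(E) = d`. -/
def radialMetric (F : (Fin (n + 1) → ℝ) → ℝ) (M : Set (Fin (n + 1) → ℝ)) (k d : ℝ)
    (x : Fin (n + 1) → ℝ) : LinearMap.BilinForm ℝ (tangent M x) :=
  (-(k * d))⁻¹ • (hessForm F x).restrict (tangent M x)

theorem mul_radialMetric {M : Set (Fin (n + 1) → ℝ)} (hkd : k * d ≠ 0) (X Y : tangent M x) :
    -(k * d) * radialMetric F M k d x X Y = fderiv ℝ (fderiv ℝ F) x X Y :=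
  mul_inv_cancel_left₀ (neg_ne_zero.2 hkd) _

namespace IsEulerRegularOn

theorem isEquiaffine_radial (hF : IsEulerRegularOn lam ε α Ω v F) (hμ : lam - (1 - ε) ≠ 0)
    (hk : k * (lam * r + α) < 0)
    (hH : ∀ x ∈ levelSet Ω F r,
      |hessDet F x| = |k| ^ (n + 2) * |lam - (1 - ε)| * |lam * r + α| ^ (n + 1)) :
    IsEquiaffine (levelSet Ω F r) (stdCoorient F) (fun x => k • radial ε v x)
      (radialMetric F (levelSet Ω F r) k (lam * r + α))
      (fun _ => -(k * (1 - ε)) • LinearMap.id) := by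
  have hk0 : k ≠ 0 := left_ne_zero_of_mul hk.ne
  have hd : lam * r + α ≠ 0 := right_ne_zero_of_mul hk.ne
  have hH0 : ∀ x ∈ levelSet Ω F r, hessDet F x ≠ 0 := fun x hx => by
    rw [← abs_ne_zero, hH x hx]
    positivity
  exact {
    hypersurface := hF.isRegularOn.isSmoothHypersurface
    smooth := ⟨Set.univ, isOpen_univ, Set.subset_univ _,
      ((contDiff_radial ε v).const_smul k).contDiffOn⟩
    transverse := fun x hx h => hF.radial_notMem_tangent hx ((Submodule.smul_mem_iff _ hk0).1 h)
    cooriented := fun x hx => by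
      obtain ⟨c, hc, h⟩ :=
        hF.exists_smul_radial_eq_smul_stdCoorient hx.1 hμ (hH0 x hx) (by rwa [hx.2])
      exact ⟨c, hc, by rw [h, sub_self]; exact zero_mem _⟩
    gauss := fun x hx X Y hY hYt hYx => by
      rw [hF.isRegularOn.fderiv_sub_smul_mem_tangent_iff hx X.2 (hY.differentiableAt (by simp)) hYt,
        map_smul, hF.fderiv_radial hx]
      exact mul_radialMetric hk.ne X ⟨Y x, hYx⟩
    weingarten := fun x _ X => by
      rw [((hasFDerivAt_radial ε v x).fun_const_smul k).fderiv]
      simp [smul_smul]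
    nondegenerate := fun x hx => by
      let b := Module.finBasisOfFinrankEq ℝ _ (hF.isRegularOn.finrank_tangent hx)
      refine LinearMap.BilinForm.nondegenerate_of_det_ne_zero _ b ?_
      convert hF.det_metric_ne_zero hx (mul_radialMetric hk.ne) (hH0 x hx) b
      ext i j
      rw [LinearMap.BilinForm.toMatrix_apply, Matrix.of_apply]
    volume := fun x hx X => by
      rw [hF.abs_det_metric_eq_det_sq_iff hx hμ hk0 (mul_radialMetric hk.ne), hH x hx] }

section Converse

variable {κ ξ : (Fin (n + 1) → ℝ) → (Fin (n + 1) → ℝ)}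
  {h : ∀ x, LinearMap.BilinForm ℝ (tangent (levelSet Ω F r) x)}
  {S : ∀ x, tangent (levelSet Ω F r) x →ₗ[ℝ] tangent (levelSet Ω F r) x}

theorem neg_mul_metric_eq (hF : IsEulerRegularOn lam ε α Ω v F)
    (hM : IsEquiaffine (levelSet Ω F r) κ ξ h S) (hx : x ∈ levelSet Ω F r)
    (hξ : ξ x = k • radial ε v x) (X Y : tangent (levelSet Ω F r) x) :
    -(k * (lam * r + α)) * h x X Y = fderiv ℝ (fderiv ℝ F) x X Y := by
  rw [← hF.isRegularOn.metric_eq hM hx, hξ, map_smul, hF.fderiv_radial hx, smul_eq_mul]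

theorem ne_zero_of_eq_smul_radial (hM : IsEquiaffine (levelSet Ω F r) κ ξ h S)
    (hx : x ∈ levelSet Ω F r) (hξ : ξ x = k • radial ε v x) : k ≠ 0 := by
  rintro rfl
  refine hM.transverse x hx ?_
  rw [hξ, zero_smul]
  exact zero_mem _

theorem abs_hessDet_eq (hF : IsEulerRegularOn lam ε α Ω v F) (hμ : lam - (1 - ε) ≠ 0)
    (hM : IsEquiaffine (levelSet Ω F r) κ ξ h S) (hx : x ∈ levelSet Ω F r)
    (hξ : ξ x = k • radial ε v x) :
    |hessDet F x| = |k| ^ (n + 2) * |lam - (1 - ε)| * |lam * r + α| ^ (n + 1) := by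
  let b := Module.finBasisOfFinrankEq ℝ _ (hF.isRegularOn.finrank_tangent hx)
  have hvol := hM.volume x hx b
  rw [hξ, hF.abs_det_metric_eq_det_sq_iff hx hμ (ne_zero_of_eq_smul_radial hM hx hξ)
    (hF.neg_mul_metric_eq hM hx hξ)] at hvol
  exact mul_right_cancel₀
    (pow_ne_zero 2 (det_vecCons_ne_zero b (hF.radial_notMem_tangent hx))) hvol

theorem hessDet_ne_zero (hF : IsEulerRegularOn lam ε α Ω v F) (hμ : lam - (1 - ε) ≠ 0)
    (hM : IsEquiaffine (levelSet Ω F r) κ ξ h S) (hx : x ∈ levelSet Ω F r)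
    (hξ : ξ x = k • radial ε v x) : hessDet F x ≠ 0 := by
  have hk := ne_zero_of_eq_smul_radial hM hx hξ
  have hd := hF.mul_add_level_ne_zero hx
  rw [← abs_ne_zero, hF.abs_hessDet_eq hμ hM hx hξ]
  positivity

theorem hessDet_eq_hessDet (hF : IsEulerRegularOn lam ε α Ω v F) (hμ : lam - (1 - ε) ≠ 0)
    (hM : IsEquiaffine (levelSet Ω F r) κ ξ h S) (hx : x ∈ levelSet Ω F r)
    (hy : y ∈ levelSet Ω F r) (hξx : ξ x = k • radial ε v x) (hξy : ξ y = k • radial ε v y)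
    (hsig : signature (h x) ≡ signature (h y) [ZMOD 4]) :
    hessDet F x = hessDet F y := by
  have hc : -(k * (lam * r + α)) ≠ 0 := neg_ne_zero.2
    (mul_ne_zero (ne_zero_of_eq_smul_radial hM hx hξx) (hF.mul_add_level_ne_zero hx))
  have hsign := (hF.signature_modEq_signature_iff_sign_hessDet hx hy hμ hc
    (hF.neg_mul_metric_eq hM hx hξx) (hF.neg_mul_metric_eq hM hy hξy)
    (hF.hessDet_ne_zero hμ hM hx hξx) (hF.hessDet_ne_zero hμ hM hy hξy)).1 hsig
  have habs := (hF.abs_hessDet_eq hμ hM hx hξx).trans (hF.abs_hessDet_eq hμ hM hy hξy).symm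
  rw [← sign_mul_abs (hessDet F x), hsign, habs, sign_mul_abs]

theorem smul_normal_eq (hF : IsEulerRegularOn lam 0 α Ω v F)
    (hξ : ∀ x ∈ levelSet Ω F r, ∃ s : ℝ, v = x + s • ξ x) (hx : x ∈ levelSet Ω F r) :
    (lam * r + α) • ξ x = fderiv ℝ F x (ξ x) • radial 0 v x := by
  obtain ⟨s, hs⟩ := hξ x hx
  have hrad : radial 0 v x = -s • ξ x := by
    rw [radial_zero, neg_smul, ← neg_sub, sub_eq_iff_eq_add'.2 hs]
  rw [← hF.fderiv_radial hx, hrad, map_smul, smul_smul, smul_eq_mul, mul_comm]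

theorem smul_shape_eq (hF : IsEulerRegularOn lam 0 α Ω v F)
    (hM : IsEquiaffine (levelSet Ω F r) κ ξ h S)
    (hξ : ∀ x ∈ levelSet Ω F r, ∃ s : ℝ, v = x + s • ξ x) (hx : x ∈ levelSet Ω F r)
    (X : tangent (levelSet Ω F r) x) :
    (lam * r + α) • S x X = -fderiv ℝ F x (ξ x) • X := by
  obtain ⟨W, hW, hMW, hsmooth⟩ := hM.smooth
  have hξx : DifferentiableAt ℝ ξ x :=
    (hsmooth.contDiffAt (hW.mem_nhds (hMW hx))).differentiableAt (by simp)
  have hb := (hF.isRegularOn.differentiableAt_fderiv hx.1).clm_apply hξx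
  have hderiv := (hξx.hasFDerivAt.fun_const_smul (lam * r + α)).fun_sub
    (hb.hasFDerivAt.fun_smul (hasFDerivAt_radial 0 v x))
  have hzero := fderiv_apply_eq_zero_of_eventually hderiv.differentiableAt
    (eventually_nhdsWithin_of_forall fun y hy => sub_eq_zero.2 (hF.smul_normal_eq hξ hy)) X.2
  rw [hderiv.fderiv] at hzero
  simp only [sub_zero, one_smul, sub_apply, add_apply, smul_apply, hM.weingarten x hx, smul_neg,
    ContinuousLinearMap.id_apply, ContinuousLinearMap.smulRight_apply] at hzero
  have htangent (Y : tangent (levelSet Ω F r) x) : fderiv ℝ F x Y = 0 :=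
    (hF.isRegularOn.mem_tangent_iff hx).1 Y.2
  have hb' : fderiv ℝ (fun y => fderiv ℝ F y (ξ y)) x X = 0 := by
    have h := congrArg (fderiv ℝ F x) hzero
    simp only [map_sub, map_add, map_neg, map_smul, htangent, hF.fderiv_radial hx, map_zero,
      smul_eq_mul, mul_zero, neg_zero, zero_add, zero_sub, neg_eq_zero] at h
    exact (mul_eq_zero.1 h).resolve_right (hF.mul_add_level_ne_zero hx)
  ext1
  rw [hb', zero_smul, add_zero] at hzero
  rw [Submodule.coe_smul, Submodule.coe_smul, neg_smul]
  linear_combination -hzero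

theorem eq_smul_radial_of_centered (hF : IsEulerRegularOn lam 0 α Ω v F) (hn : n ≠ 0)
    (hM : IsEquiaffine (levelSet Ω F r) κ ξ h S)
    (hξ : ∀ x ∈ levelSet Ω F r, ∃ s : ℝ, v = x + s • ξ x) {A : ℝ}
    (hA : HasMeanCurvature (levelSet Ω F r) S A) (hx : x ∈ levelSet Ω F r) :
    ξ x = -A • radial 0 v x := by
  have hd := hF.mul_add_level_ne_zero hx
  have hS : (lam * r + α) • S x = -fderiv ℝ F x (ξ x) • LinearMap.id :=
    LinearMap.ext (hF.smul_shape_eq hM hξ hx)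
  have htrace := congrArg (LinearMap.trace ℝ _) hS
  rw [map_smul, map_smul, LinearMap.trace_id, hF.isRegularOn.finrank_tangent hx, smul_eq_mul,
    smul_eq_mul] at htrace
  have hbA : fderiv ℝ F x (ξ x) = (lam * r + α) * -A := by
    rw [← hA x hx]
    field_simp
    linear_combination htrace
  refine (smul_right_inj hd).1 ?_
  rw [hF.smul_normal_eq hξ hx, hbA, smul_smul]

theorem exists_hessDet_eq (hF : IsEulerRegularOn lam ε α Ω v F) (hμ : lam - (1 - ε) ≠ 0)
    (hM : IsEquiaffine (levelSet Ω F r) κ ξ h S)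
    (hξ : ∀ x ∈ levelSet Ω F r, ξ x = k • radial ε v x)
    (hsig : ∀ x ∈ levelSet Ω F r, ∀ y ∈ levelSet Ω F r,
      signature (h x) ≡ signature (h y) [ZMOD 4]) :
    ∃ p, p ≠ 0 ∧ ∀ x ∈ levelSet Ω F r, hessDet F x = p := by
  rcases (levelSet Ω F r).eq_empty_or_nonempty with hempty | ⟨y, hy⟩
  · exact ⟨1, one_ne_zero, by simp [hempty]⟩
  · exact ⟨hessDet F y, hF.hessDet_ne_zero hμ hM hy (hξ y hy), fun x hx =>
      hF.hessDet_eq_hessDet hμ hM hx hy (hξ x hx) (hξ y hy) (hsig x hx y hy)⟩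

end Converse

end IsEulerRegularOn

end AffineNormal

section LevelCurvature

variable {n : ℕ} {lam ε α r k μ d p : ℝ} {Ω : Set (Fin (n + 1) → ℝ)} {v x y : Fin (n + 1) → ℝ}
  {F : (Fin (n + 1) → ℝ) → ℝ}

/-- The solution `A` of `|A| ^ (n + 2) * |μ| * |d| ^ (n + 1) = |p|` with the sign of `d`. For
`μ = λ - 1`, `d = λ r + α` and `p` the Hessian determinant on the level set of `r`, this is the
affine mean curvature of that level set. -/
def levelCurvature (n : ℕ) (μ d p : ℝ) : ℝ :=
  Real.sign d * |μ| ^ (-1 / ((n : ℝ) + 2)) * |d| ^ (-((n : ℝ) + 1) / ((n : ℝ) + 2)) *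
    |p| ^ (1 / ((n : ℝ) + 2))

theorem levelCurvature_mul_pos (hμ : μ ≠ 0) (hd : d ≠ 0) (hp : p ≠ 0) :
    0 < levelCurvature n μ d p * d := by
  have hsign := Real.sign_mul_pos_of_ne_zero d hd
  have hroots : 0 < |μ| ^ (-1 / ((n : ℝ) + 2)) * |d| ^ (-((n : ℝ) + 1) / ((n : ℝ) + 2)) *
      |p| ^ (1 / ((n : ℝ) + 2)) := by
    positivity
  rw [levelCurvature]
  linear_combination mul_pos hsign hroots

theorem abs_levelCurvature_pow (hμ : μ ≠ 0) (hd : d ≠ 0) :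
    |levelCurvature n μ d p| ^ (n + 2) * |μ| * |d| ^ (n + 1) = |p| := by
  have hroot (y s : ℝ) : (|y| ^ (s / ((n : ℝ) + 2))) ^ (n + 2) = |y| ^ s := by
    rw [← Real.rpow_mul_natCast (abs_nonneg y)]
    congr 1
    push_cast
    field_simp
  have hsign : |Real.sign d| = 1 := by
    rcases Real.sign_apply_eq_of_ne_zero d hd with h | h <;> simp [h]
  have habs (y s : ℝ) : |(|y| ^ s)| = |y| ^ s := abs_of_nonneg (by positivity)
  have hdpow : |d| ^ (-((n : ℝ) + 1)) = (|d| ^ (n + 1))⁻¹ := by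
    rw [Real.rpow_neg (abs_nonneg d), ← Nat.cast_add_one, Real.rpow_natCast]
  rw [levelCurvature, abs_mul, abs_mul, abs_mul, hsign, habs, habs, habs, one_mul, mul_pow,
    mul_pow, hroot, hroot, hroot, hdpow, Real.rpow_neg_one, Real.rpow_one]
  field_simp

theorem levelCurvature_mul_rpow (hr : r ≠ 0) (B : ℝ) :
    levelCurvature n μ (lam * r) (B * |r| ^ (((n : ℝ) + 1) * (lam - 2) / lam)) =
      Real.sign (lam * r) * |μ| ^ (-1 / ((n : ℝ) + 2)) *
        |lam| ^ (-((n : ℝ) + 1) / ((n : ℝ) + 2)) * |B| ^ (1 / ((n : ℝ) + 2)) *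
        |r| ^ (((n : ℝ) + 1) * (lam - 2) / (((n : ℝ) + 2) * lam) -
          ((n : ℝ) + 1) / ((n : ℝ) + 2)) := by
  have hexponent : ((n : ℝ) + 1) * (lam - 2) / (((n : ℝ) + 2) * lam) -
      ((n : ℝ) + 1) / ((n : ℝ) + 2) =
        -((n : ℝ) + 1) / ((n : ℝ) + 2) +
          ((n : ℝ) + 1) * (lam - 2) / lam * (1 / ((n : ℝ) + 2)) := by
    rw [div_mul_div_comm, mul_one, mul_comm lam, neg_div, sub_eq_neg_add]
  rw [levelCurvature, hexponent, Real.rpow_add (abs_pos.2 hr), Real.rpow_mul (abs_nonneg r),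
    abs_mul lam, abs_mul B, abs_of_nonneg (Real.rpow_nonneg (abs_nonneg r) _),
    Real.mul_rpow (abs_nonneg lam) (abs_nonneg r), Real.mul_rpow (abs_nonneg B) (by positivity)]
  ring

theorem levelCurvature_mul_exp (n : ℕ) (α B r : ℝ) :
    levelCurvature n (-1) α (B * Real.exp (-2 * ((n : ℝ) + 1) * r / α)) =
      Real.sign α * |α| ^ (-((n : ℝ) + 1) / ((n : ℝ) + 2)) * |B| ^ (1 / ((n : ℝ) + 2)) *
        Real.exp (-2 * ((n : ℝ) + 1) * r / (α * ((n : ℝ) + 2))) := by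
  rw [levelCurvature, abs_neg, abs_one, Real.one_rpow, abs_mul B,
    Real.mul_rpow (abs_nonneg _) (abs_nonneg _), Real.abs_exp, ← Real.exp_mul, div_mul_div_comm,
    mul_one, mul_one]
  ring

namespace IsEulerRegularOn

theorem hasMeanCurvature_smul_id (hF : IsEulerRegularOn lam ε α Ω v F) (hn : n ≠ 0) (c : ℝ) :
    HasMeanCurvature (levelSet Ω F r) (fun _ => c • LinearMap.id) c := fun x hx => by
  rw [map_smul, LinearMap.trace_id, hF.isRegularOn.finrank_tangent hx, smul_eq_mul]
  field_simp

theorem isEquiaffine_levelCurvature (hF : IsEulerRegularOn lam ε α Ω v F)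
    (hμ : lam - (1 - ε) ≠ 0) (hd : lam * r + α ≠ 0) (hp : p ≠ 0)
    (hH : ∀ x ∈ levelSet Ω F r, hessDet F x = p)
    (hk : k = -levelCurvature n (lam - (1 - ε)) (lam * r + α) p) :
    IsEquiaffine (levelSet Ω F r) (stdCoorient F) (fun x => k • radial ε v x)
      (radialMetric F (levelSet Ω F r) k (lam * r + α))
      (fun _ => -(k * (1 - ε)) • LinearMap.id) := by
  subst hk
  refine hF.isEquiaffine_radial hμ ?_ fun x hx => ?_
  · rw [neg_mul]
    exact neg_neg_of_pos (levelCurvature_mul_pos hμ hd hp)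
  · rw [hH x hx, abs_neg, abs_levelCurvature_pow hμ hd]

theorem signature_radialMetric_modEq (hF : IsEulerRegularOn lam ε α Ω v F)
    (hμ : lam - (1 - ε) ≠ 0) (hk : k ≠ 0) (hx : x ∈ levelSet Ω F r) (hy : y ∈ levelSet Ω F r)
    (hH : hessDet F x = hessDet F y) (hHx : hessDet F x ≠ 0) :
    signature (radialMetric F (levelSet Ω F r) k (lam * r + α) x) ≡
      signature (radialMetric F (levelSet Ω F r) k (lam * r + α) y) [ZMOD 4] := by
  have hkd := mul_ne_zero hk (hF.mul_add_level_ne_zero hx)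
  exact (hF.signature_modEq_signature_iff_sign_hessDet hx hy hμ (neg_ne_zero.2 hkd)
    (mul_radialMetric hkd) (mul_radialMetric hkd) hHx (hH ▸ hHx)).2 (by rw [hH])

theorem hasAffineMeanCurvature (hF : IsEulerRegularOn lam ε α Ω v F) (hn : n ≠ 0)
    (hμ : lam - (1 - ε) ≠ 0) (hd : lam * r + α ≠ 0) (hp : p ≠ 0)
    (hH : ∀ x ∈ levelSet Ω F r, hessDet F x = p) :
    HasAffineMeanCurvature (levelSet Ω F r) (stdCoorient F)
      ((1 - ε) * levelCurvature n (lam - (1 - ε)) (lam * r + α) p) :=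
  ⟨_, _, _, hF.isEquiaffine_levelCurvature hμ hd hp hH rfl,
    by convert hF.hasMeanCurvature_smul_id hn _ using 1; ring⟩

theorem adjQuad_eq (hF : IsEulerRegularOn lam ε α Ω v F) (hμ : lam - (1 - ε) ≠ 0)
    (hx : x ∈ levelSet Ω F r) :
    adjQuad F x = (lam * r + α) / (lam - (1 - ε)) * hessDet F x := by
  have h := hF.mul_adjQuad hx.1
  rw [hx.2] at h
  field_simp
  linear_combination h

theorem exists_hessDet_eq_iff_exists_adjQuad_eq (hF : IsEulerRegularOn lam ε α Ω v F)
    (hμ : lam - (1 - ε) ≠ 0) (hd : lam * r + α ≠ 0) :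
    (∃ p, p ≠ 0 ∧ ∀ x ∈ levelSet Ω F r, hessDet F x = p) ↔
      ∃ q, q ≠ 0 ∧ ∀ x ∈ levelSet Ω F r, adjQuad F x = q := by
  have hc : (lam * r + α) / (lam - (1 - ε)) ≠ 0 := div_ne_zero hd hμ
  constructor
  · rintro ⟨p, hp, hH⟩
    exact ⟨_, mul_ne_zero hc hp, fun x hx => by rw [hF.adjQuad_eq hμ hx, hH x hx]⟩
  · rintro ⟨q, hq, hU⟩
    exact ⟨_, div_ne_zero hq hc, fun x hx => by
      rw [eq_div_iff hc, mul_comm, ← hF.adjQuad_eq hμ hx, hU x hx]⟩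

theorem exists_hessDet_eq_iff_isProperAffineSphere (hF : IsEulerRegularOn lam 0 α Ω v F)
    (hn : n ≠ 0) (hlam : lam ≠ 1) (hd : lam * r + α ≠ 0) :
    (∃ p, p ≠ 0 ∧ ∀ x ∈ levelSet Ω F r, hessDet F x = p) ↔
      IsProperAffineSphere (levelSet Ω F r) (stdCoorient F) v := by
  have hμ : lam - (1 - 0) ≠ 0 := by rwa [sub_zero, sub_ne_zero]
  constructor
  · rintro ⟨p, hp, hH⟩
    let A := levelCurvature n (lam - (1 - 0)) (lam * r + α) p
    have hA : A ≠ 0 := left_ne_zero_of_mul (levelCurvature_mul_pos hμ hd hp).ne'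
    refine ⟨_, _, _, hF.isEquiaffine_levelCurvature (k := -A) hμ hd hp hH rfl, fun x _ => ⟨A⁻¹, ?_⟩,
      ⟨A, hA, ?_⟩, fun x hx y hy => hF.signature_radialMetric_modEq hμ (neg_ne_zero.2 hA) hx hy
        (by rw [hH x hx, hH y hy]) (by rwa [hH x hx])⟩
    · rw [neg_smul, smul_neg, inv_smul_smul₀ hA, radial_zero, neg_sub, add_sub_cancel]
    · convert hF.hasMeanCurvature_smul_id hn A using 4
      ring
  · rintro ⟨ξ, h, S, hM, hξ, ⟨A, -, hA⟩, hsig⟩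
    exact hF.exists_hessDet_eq hμ hM (fun x hx => hF.eq_smul_radial_of_centered hn hM hξ hA hx) hsig

theorem exists_hessDet_eq_iff_isImproperAffineSphere (hF : IsEulerRegularOn lam 1 α Ω v F)
    (hlam : lam ≠ 0) (hd : lam * r + α ≠ 0) :
    (∃ p, p ≠ 0 ∧ ∀ x ∈ levelSet Ω F r, hessDet F x = p) ↔
      IsImproperAffineSphere (levelSet Ω F r) (stdCoorient F) v := by
  have hμ : lam - (1 - 1) ≠ 0 := by rwa [sub_self, sub_zero]
  constructor
  · rintro ⟨p, hp, hH⟩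
    let A := levelCurvature n (lam - (1 - 1)) (lam * r + α) p
    have hA : A ≠ 0 := left_ne_zero_of_mul (levelCurvature_mul_pos hμ hd hp).ne'
    refine ⟨_, _, _, hF.isEquiaffine_levelCurvature (k := -A) hμ hd hp hH rfl,
      ⟨-A, fun x _ => by rw [radial_one]⟩, fun x _ => by simp,
      fun x hx y hy => hF.signature_radialMetric_modEq hμ (neg_ne_zero.2 hA) hx hy
        (by rw [hH x hx, hH y hy]) (by rwa [hH x hx])⟩
  · rintro ⟨ξ, h, S, hM, ⟨c, hξ⟩, -, hsig⟩
    exact hF.exists_hessDet_eq hμ hM (fun x hx => by rw [hξ x hx, radial_one]) hsig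

end IsEulerRegularOn

end LevelCurvature

section Profile

variable {n : ℕ} {lam ε α r s t : ℝ} {Ω U : Set (Fin (n + 1) → ℝ)} {I : Set ℝ}
  {v x : Fin (n + 1) → ℝ} {F : (Fin (n + 1) → ℝ) → ℝ} {φ ψ w : ℝ → ℝ}

/-- The flow of the radial field, when `ε = 0` or `ε = 1`. -/
def radialFlow (ε : ℝ) (v : Fin (n + 1) → ℝ) (t : ℝ) (x : Fin (n + 1) → ℝ) : Fin (n + 1) → ℝ :=
  (1 - ε) • (Real.exp t • (x - v) + v) + ε • (x + t • v)

theorem radialFlow_zero (ε : ℝ) (v x : Fin (n + 1) → ℝ) : radialFlow ε v 0 x = x := by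
  simp [radialFlow, ← add_smul]

theorem radialFlow_eq_smul_add (ε : ℝ) (v : Fin (n + 1) → ℝ) (t : ℝ) (x : Fin (n + 1) → ℝ) :
    radialFlow ε v t x = ((1 - ε) * Real.exp t + ε) • x + radialFlow ε v t 0 := by
  simp only [radialFlow]
  module

theorem hasDerivAt_radialFlow (ε : ℝ) (v x : Fin (n + 1) → ℝ) :
    HasDerivAt (fun t => radialFlow ε v t x) (radial ε v x) 0 := by
  have hdilation := ((Real.hasDerivAt_exp 0).smul_const (x - v)).add_const v
  have htranslation := ((hasDerivAt_id (0 : ℝ)).smul_const v).const_add x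
  simpa [radial, radialFlow] using
    (hdilation.fun_const_smul (1 - ε)).fun_add (htranslation.fun_const_smul ε)

theorem eventually_radialFlow_mem (ε : ℝ) (v : Fin (n + 1) → ℝ) (hU : IsOpen U) (hx : x ∈ U) :
    ∀ᶠ t in 𝓝 0, radialFlow ε v t x ∈ U :=
  (hasDerivAt_radialFlow ε v x).continuousAt.eventually_mem
    (hU.mem_nhds (by rwa [radialFlow_zero]))

/-- The action `s ↦ e^{λ t} s + α t` of the radial flow on the values of an affinely homogeneous
function. -/
def valueFlow (lam α t s : ℝ) : ℝ :=
  Real.exp (lam * t) * s + α * t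

theorem valueFlow_zero (lam α s : ℝ) : valueFlow lam α 0 s = s := by
  simp [valueFlow]

theorem hasStrictDerivAt_valueFlow (lam α s : ℝ) :
    HasStrictDerivAt (fun t => valueFlow lam α t s) (lam * s + α) 0 := by
  have hid := hasStrictDerivAt_id (0 : ℝ)
  simpa [valueFlow] using ((hid.const_mul lam).exp.mul_const s).fun_add (hid.const_mul α)

theorem map_valueFlow_nhds (hs : lam * s + α ≠ 0) :
    Filter.map (fun t => valueFlow lam α t s) (𝓝 0) = 𝓝 s := by
  rw [(hasStrictDerivAt_valueFlow lam α s).map_nhds_eq hs, valueFlow_zero]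

/-- `w` scales under the flow on values as the Hessian determinant of an affinely homogeneous
function scales under the radial flow. -/
def IsHessianWeight (n : ℕ) (lam ε α : ℝ) (w : ℝ → ℝ) : Prop :=
  ∀ t s, (((1 - ε) * Real.exp t + ε) ^ 2) ^ (n + 1) * w (valueFlow lam α t s) =
    Real.exp (lam * t) ^ (n + 1) * w s

theorem isHessianWeight_abs_rpow (n : ℕ) (hlam : lam ≠ 0) :
    IsHessianWeight n lam 0 0 fun s => |s| ^ (((n : ℝ) + 1) * (lam - 2) / lam) := by
  intro t s
  simp only [valueFlow, sub_zero, one_mul, zero_mul, add_zero]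
  rw [abs_mul, Real.mul_rpow (abs_nonneg _) (abs_nonneg _), Real.abs_exp, ← Real.exp_mul,
    ← mul_assoc, ← Real.exp_nat_mul, ← Real.exp_nat_mul, ← Real.exp_nat_mul, ← Real.exp_add]
  congr 2
  push_cast
  field_simp
  ring

theorem isHessianWeight_exp (n : ℕ) (hα : α ≠ 0) :
    IsHessianWeight n 0 0 α fun s => Real.exp (-2 * ((n : ℝ) + 1) * s / α) := by
  intro t s
  simp only [valueFlow, sub_zero, one_mul, zero_mul, add_zero, Real.exp_zero, one_pow]
  rw [← Real.exp_nat_mul, ← Real.exp_nat_mul, ← Real.exp_add]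
  congr 1
  push_cast
  field_simp
  ring

theorem isHessianWeight_pow (n : ℕ) (lam : ℝ) :
    IsHessianWeight n lam 1 0 fun s => s ^ (n + 1) := by
  intro t s
  simp only [valueFlow]
  ring

theorem exists_eq_mul_of_isPreconnected {X K : Type*} [TopologicalSpace X] [Field K] {J : Set X}
    {φ w : X → K} (hJ : IsPreconnected J) (hφ : ∀ r ∈ J, φ r ≠ 0) (hw : ∀ r ∈ J, w r ≠ 0)
    (hloc : ∀ r ∈ J, ∀ᶠ s in 𝓝[J] r, φ s / w s = φ r / w r) :
    ∃ B, B ≠ 0 ∧ ∀ r ∈ J, φ r = B * w r := by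
  rcases J.eq_empty_or_nonempty with rfl | ⟨r₀, hr₀⟩
  · exact ⟨1, one_ne_zero, by simp⟩
  have : PreconnectedSpace J := Subtype.preconnectedSpace hJ
  have hconst : IsLocallyConstant fun r : J => φ r / w r :=
    (IsLocallyConstant.iff_eventually_eq _).2 fun r =>
      (eventually_nhds_subtype_iff J r fun s => φ s / w s = φ r / w r).2 (hloc r r.2)
  refine ⟨φ r₀ / w r₀, div_ne_zero (hφ r₀ hr₀) (hw r₀ hr₀), fun r hr => ?_⟩
  rw [← div_eq_iff (hw r hr)]
  exact hconst.apply_eq_of_preconnectedSpace ⟨r, hr⟩ ⟨r₀, hr₀⟩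

namespace IsAffinelyHomogeneous

theorem apply_radialFlow (hF : IsAffinelyHomogeneous lam ε α Ω v F) (hx : x ∈ Ω)
    (hxt : radialFlow ε v t x ∈ Ω) : F (radialFlow ε v t x) = valueFlow lam α t (F x) :=
  hF.homogeneous t x hx hxt

theorem isEulerRegularOn (hF : IsAffinelyHomogeneous lam ε α Ω v F) (hΩ : IsOpen Ω)
    (hI : IsOpen I) (hIreg : ∀ r ∈ I, lam * r + α ≠ 0) :
    IsEulerRegularOn lam ε α (Ω ∩ F ⁻¹' I) v F := by
  have hopen : IsOpen (Ω ∩ F ⁻¹' I) := hF.continuousOn.isOpen_inter_preimage hΩ hI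
  have hsmooth : ContDiffOn ℝ ∞ F (Ω ∩ F ⁻¹' I) := by
    refine hF.smoothOn.mono fun y hy => ⟨hy.1, ?_⟩
    rintro ⟨hlam, hFy⟩
    exact hIreg _ hy.2 (by rw [hFy, mul_div_cancel₀ _ hlam, neg_add_cancel])
  refine ⟨hopen, hsmooth, fun x hx => ?_, fun x hx => hIreg _ hx.2⟩
  have hdF : HasFDerivAt F (fderiv ℝ F x) (radialFlow ε v 0 x) := by
    rw [radialFlow_zero]
    exact ((hsmooth.contDiffAt (hopen.mem_nhds hx)).differentiableAt (by simp)).hasFDerivAt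
  have heq : F ∘ (fun t => radialFlow ε v t x) =ᶠ[𝓝 0] fun t => valueFlow lam α t (F x) :=
    (eventually_radialFlow_mem ε v hΩ hx.1).mono fun t ht => hF.apply_radialFlow hx.1 ht
  exact ((hdF.comp_hasDerivAt 0 (hasDerivAt_radialFlow ε v x)).congr_of_eventuallyEq
    heq.symm).unique (hasStrictDerivAt_valueFlow lam α (F x)).hasDerivAt

theorem hessDet_radialFlow (hF : IsAffinelyHomogeneous lam ε α Ω v F) (hΩ : IsOpen Ω)
    (hx : x ∈ Ω) (hxt : radialFlow ε v t x ∈ Ω) :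
    (((1 - ε) * Real.exp t + ε) ^ 2) ^ (n + 1) * hessDet F (radialFlow ε v t x) =
      Real.exp (lam * t) ^ (n + 1) * hessDet F x := by
  let a := (1 - ε) * Real.exp t + ε
  have hflow : radialFlow ε v t = fun y => a • y + radialFlow ε v t 0 :=
    funext (radialFlow_eq_smul_add ε v t)
  have hcont : Continuous (radialFlow ε v t) := by
    rw [hflow]
    fun_prop
  have heq : (fun y => F (a • y + radialFlow ε v t 0)) =ᶠ[𝓝 x]
      fun y => Real.exp (lam * t) * F y + α * t := by
    filter_upwards [hΩ.mem_nhds hx, hcont.continuousAt.eventually_mem (hΩ.mem_nhds hxt)]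
      with y hy hyt
    rw [← radialFlow_eq_smul_add]
    exact hF.apply_radialFlow hy hyt
  have hhess := hess_congr heq
  rw [hess_comp_smul_add, hess_const_mul_add_const, ← radialFlow_eq_smul_add] at hhess
  simpa only [hessDet, Matrix.det_smul, Fintype.card_fin] using congrArg Matrix.det hhess

end IsAffinelyHomogeneous

/-- `F` is affinely homogeneous on the open set `Ω`, and where its values lie in the open set `I` of
regular values, its Hessian determinant is `φ(F)` and its adjugate quadratic form is `ψ(F)`, with
`φ` nonvanishing. -/
structure IsProfile (lam ε α : ℝ) (Ω : Set (Fin (n + 1) → ℝ)) (I : Set ℝ) (v : Fin (n + 1) → ℝ)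
    (F : (Fin (n + 1) → ℝ) → ℝ) (φ ψ : ℝ → ℝ) : Prop where
  homogeneous : IsAffinelyHomogeneous lam ε α Ω v F
  isOpen : IsOpen Ω
  isOpen_values : IsOpen I
  mul_add_ne_zero : ∀ r ∈ I, lam * r + α ≠ 0
  ne_zero : ∀ r ∈ I, φ r ≠ 0
  hessDet_eq : ∀ x ∈ Ω ∩ F ⁻¹' I, hessDet F x = φ (F x)
  adjQuad_eq : ∀ x ∈ Ω ∩ F ⁻¹' I, adjQuad F x = ψ (F x)

namespace IsProfile

theorem isEulerRegularOn (h : IsProfile lam ε α Ω I v F φ ψ) :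
    IsEulerRegularOn lam ε α (Ω ∩ F ⁻¹' I) v F :=
  h.homogeneous.isEulerRegularOn h.isOpen h.isOpen_values h.mul_add_ne_zero

theorem eventually_div_eq (h : IsProfile lam ε α Ω I v F φ ψ) (hw : IsHessianWeight n lam ε α w)
    (hw0 : ∀ r ∈ I, w r ≠ 0) (hr : r ∈ F '' (Ω ∩ F ⁻¹' I)) :
    ∀ᶠ s in 𝓝 r, φ s / w s = φ r / w r := by
  obtain ⟨x, hx, rfl⟩ := hr
  have ha : ∀ᶠ t in 𝓝 (0 : ℝ), (1 - ε) * Real.exp t + ε ≠ 0 := by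
    have hcont : ContinuousAt (fun t : ℝ => (1 - ε) * Real.exp t + ε) 0 := by fun_prop
    exact hcont.eventually_ne (by simp)
  rw [← map_valueFlow_nhds (h.mul_add_ne_zero _ hx.2), Filter.eventually_map]
  filter_upwards [eventually_radialFlow_mem ε v h.isEulerRegularOn.isOpen hx, ha] with t hxt ha
  have hFt := h.homogeneous.apply_radialFlow hx.1 hxt.1
  have hH := h.homogeneous.hessDet_radialFlow h.isOpen hx.1 hxt.1
  rw [h.hessDet_eq _ hxt, h.hessDet_eq _ hx, hFt] at hH
  rw [div_eq_div_iff (hw0 _ (hFt ▸ hxt.2)) (hw0 _ hx.2)]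
  refine mul_left_cancel₀ (pow_ne_zero (n + 1) (pow_ne_zero 2 ha)) ?_
  linear_combination w (F x) * hH - φ (F x) * hw t (F x)

theorem exists_eq_mul (h : IsProfile lam ε α Ω I v F φ ψ)
    (hconn : IsPreconnected (F '' (Ω ∩ F ⁻¹' I))) (hw : IsHessianWeight n lam ε α w)
    (hw0 : ∀ r ∈ I, w r ≠ 0) : ∃ B, B ≠ 0 ∧ ∀ r ∈ F '' (Ω ∩ F ⁻¹' I), φ r = B * w r := by
  have hsub : F '' (Ω ∩ F ⁻¹' I) ⊆ I := Set.image_subset_iff.2 Set.inter_subset_right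
  exact exists_eq_mul_of_isPreconnected hconn (fun r hr => h.ne_zero r (hsub hr))
    (fun r hr => hw0 r (hsub hr))
    fun r hr => (h.eventually_div_eq hw hw0 hr).filter_mono nhdsWithin_le_nhds

theorem adjQuad_profile_eq (h : IsProfile lam ε α Ω I v F φ ψ) (hμ : lam - (1 - ε) ≠ 0)
    (hr : r ∈ F '' (Ω ∩ F ⁻¹' I)) : ψ r = (lam * r + α) / (lam - (1 - ε)) * φ r := by
  obtain ⟨x, hx, rfl⟩ := hr
  rw [← h.adjQuad_eq x hx, ← h.hessDet_eq x hx, h.isEulerRegularOn.adjQuad_eq hμ ⟨hx, rfl⟩]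

theorem hasAffineMeanCurvature (h : IsProfile lam ε α Ω I v F φ ψ) (hn : n ≠ 0)
    (hμ : lam - (1 - ε) ≠ 0) (hr : r ∈ I) :
    HasAffineMeanCurvature (levelSet Ω F r) (stdCoorient F)
      ((1 - ε) * levelCurvature n (lam - (1 - ε)) (lam * r + α) (φ r)) := by
  rw [← levelSet_inter_preimage hr]
  exact h.isEulerRegularOn.hasAffineMeanCurvature hn hμ (h.mul_add_ne_zero r hr) (h.ne_zero r hr)
    fun x hx => by rw [h.hessDet_eq x hx.1, hx.2]

theorem exists_power_law (h : IsProfile lam 0 0 Ω I v F φ ψ) (hn : n ≠ 0) (hlam0 : lam ≠ 0)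
    (hlam1 : lam ≠ 1) (hconn : IsPreconnected (F '' (Ω ∩ F ⁻¹' I))) :
    ∃ B : ℝ, B ≠ 0 ∧ ∀ r ∈ F '' (Ω ∩ F ⁻¹' I),
      φ r = B * |r| ^ (((n : ℝ) + 1) * (lam - 2) / lam) ∧
      ψ r = lam / (lam - 1) * r * φ r ∧
      HasAffineMeanCurvature (levelSet Ω F r) (stdCoorient F)
        (Real.sign (lam * r) * |lam - 1| ^ (-1 / ((n : ℝ) + 2)) *
          |lam| ^ (-((n : ℝ) + 1) / ((n : ℝ) + 2)) * |B| ^ (1 / ((n : ℝ) + 2)) *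
          |r| ^ (((n : ℝ) + 1) * (lam - 2) / (((n : ℝ) + 2) * lam) -
            ((n : ℝ) + 1) / ((n : ℝ) + 2))) := by
  have hμ : lam - (1 - 0) ≠ 0 := by rwa [sub_zero, sub_ne_zero]
  have hI0 (r) (hr : r ∈ I) : r ≠ 0 := by
    rintro rfl
    exact h.mul_add_ne_zero 0 hr (by ring)
  obtain ⟨B, hB, hφ⟩ := h.exists_eq_mul hconn (isHessianWeight_abs_rpow n hlam0)
    fun r hr => (Real.rpow_pos_of_pos (abs_pos.2 (hI0 r hr)) _).ne'
  refine ⟨B, hB, fun r hr => ⟨hφ r hr, ?_, ?_⟩⟩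
  · rw [h.adjQuad_profile_eq hμ hr, sub_zero, add_zero, mul_div_right_comm]
  · have hrI : r ∈ I := Set.image_subset_iff.2 Set.inter_subset_right hr
    have hcurv := h.hasAffineMeanCurvature hn hμ hrI
    rwa [hφ r hr, sub_zero, one_mul, add_zero, levelCurvature_mul_rpow (hI0 r hrI)] at hcurv

theorem exists_exponential_law (h : IsProfile 0 0 α Ω I v F φ ψ) (hn : n ≠ 0) (hα : α ≠ 0)
    (hconn : IsPreconnected (F '' (Ω ∩ F ⁻¹' I))) :
    ∃ B : ℝ, B ≠ 0 ∧ ∀ r ∈ F '' (Ω ∩ F ⁻¹' I),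
      φ r = B * Real.exp (-2 * ((n : ℝ) + 1) * r / α) ∧
      ψ r = -α * φ r ∧
      HasAffineMeanCurvature (levelSet Ω F r) (stdCoorient F)
        (Real.sign α * |α| ^ (-((n : ℝ) + 1) / ((n : ℝ) + 2)) * |B| ^ (1 / ((n : ℝ) + 2)) *
          Real.exp (-2 * ((n : ℝ) + 1) * r / (α * ((n : ℝ) + 2)))) := by
  have hμ : (0 : ℝ) - (1 - 0) ≠ 0 := by norm_num
  obtain ⟨B, hB, hφ⟩ := h.exists_eq_mul hconn (isHessianWeight_exp n hα)
    fun r _ => (Real.exp_pos _).ne'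
  refine ⟨B, hB, fun r hr => ⟨hφ r hr, ?_, ?_⟩⟩
  · rw [h.adjQuad_profile_eq hμ hr]
    ring
  · have hrI : r ∈ I := Set.image_subset_iff.2 Set.inter_subset_right hr
    have hcurv := h.hasAffineMeanCurvature hn hμ hrI
    rwa [hφ r hr, zero_mul, zero_add, sub_zero, zero_sub, one_mul, levelCurvature_mul_exp] at hcurv

theorem exists_polynomial_law (h : IsProfile lam 1 0 Ω I v F φ ψ) (hn : n ≠ 0)
    (hlam : lam ≠ 0) (hconn : IsPreconnected (F '' (Ω ∩ F ⁻¹' I))) :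
    ∃ B : ℝ, B ≠ 0 ∧ ∀ r ∈ F '' (Ω ∩ F ⁻¹' I),
      φ r = B * r ^ (n + 1) ∧ ψ r = r * φ r ∧
      HasAffineMeanCurvature (levelSet Ω F r) (stdCoorient F) 0 := by
  have hμ : lam - (1 - 1) ≠ 0 := by rwa [sub_self, sub_zero]
  have hI0 (r) (hr : r ∈ I) : r ≠ 0 := by
    rintro rfl
    exact h.mul_add_ne_zero 0 hr (by ring)
  obtain ⟨B, hB, hφ⟩ := h.exists_eq_mul hconn (isHessianWeight_pow n lam)
    fun r hr => pow_ne_zero (n + 1) (hI0 r hr)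
  refine ⟨B, hB, fun r hr => ⟨hφ r hr, ?_, ?_⟩⟩
  · rw [h.adjQuad_profile_eq hμ hr]
    field_simp
    ring
  · have hrI : r ∈ I := Set.image_subset_iff.2 Set.inter_subset_right hr
    have hcurv := h.hasAffineMeanCurvature hn hμ hrI
    rwa [sub_self, zero_mul] at hcurv

end IsProfile

end Profile

end AffineSphere

end

theorem theorem1 (n : ℕ) (hn : 1 ≤ n) (lam ε α : ℝ) (hε : ε = 0 ∨ ε = 1)
    (hne : ¬ (α = 0 ∧ lam = 0)) (hαlam : α * lam = 0) (hαε : α * ε = 0) (hlam : lam ≠ 1 - ε)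
    (Ω : Set (Fin (n + 1) → ℝ)) (hΩ : IsOpen Ω) (hΩne : Ω.Nonempty)
    (I : Set ℝ) (hI : IsOpen I) (hIconn : IsConnected I) (hIreg : ∀ r ∈ I, lam * r + α ≠ 0)
    (v : Fin (n + 1) → ℝ) (F : (Fin (n + 1) → ℝ) → ℝ)
    (hF : AffineSphere.IsAffinelyHomogeneous lam ε α Ω v F) :
    ((∃ φ : ℝ → ℝ, (∀ r ∈ I, φ r ≠ 0) ∧
        ∀ x ∈ Ω ∩ F ⁻¹' I, AffineSphere.hessDet F x = φ (F x)) ↔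
      (∃ ψ : ℝ → ℝ, (∀ r ∈ I, ψ r ≠ 0) ∧
        ∀ x ∈ Ω ∩ F ⁻¹' I, AffineSphere.adjQuad F x = ψ (F x))) ∧
    (ε = 0 →
      ((∃ φ : ℝ → ℝ, (∀ r ∈ I, φ r ≠ 0) ∧
          ∀ x ∈ Ω ∩ F ⁻¹' I, AffineSphere.hessDet F x = φ (F x)) ↔
        ∀ r ∈ I, AffineSphere.IsProperAffineSphere {x ∈ Ω | F x = r}
          (AffineSphere.stdCoorient F) v)) ∧
    (ε = 1 →
      ((∃ φ : ℝ → ℝ, (∀ r ∈ I, φ r ≠ 0) ∧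
          ∀ x ∈ Ω ∩ F ⁻¹' I, AffineSphere.hessDet F x = φ (F x)) ↔
        ∀ r ∈ I, AffineSphere.IsImproperAffineSphere {x ∈ Ω | F x = r}
          (AffineSphere.stdCoorient F) v)) ∧
    (∀ φ ψ : ℝ → ℝ, (∀ r ∈ I, φ r ≠ 0) → (∀ r ∈ I, ψ r ≠ 0) →
      (∀ x ∈ Ω ∩ F ⁻¹' I, AffineSphere.hessDet F x = φ (F x)) →
      (∀ x ∈ Ω ∩ F ⁻¹' I, AffineSphere.adjQuad F x = ψ (F x)) →
      IsPreconnected (F '' (Ω ∩ F ⁻¹' I)) →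
      ∃ B : ℝ, B ≠ 0 ∧ ∀ r ∈ F '' (Ω ∩ F ⁻¹' I),
        (α = 0 → ε = 0 →
          φ r = B * |r| ^ (((n : ℝ) + 1) * (lam - 2) / lam) ∧
          ψ r = lam / (lam - 1) * r * φ r ∧
          AffineSphere.HasAffineMeanCurvature {x ∈ Ω | F x = r} (AffineSphere.stdCoorient F)
            (Real.sign (lam * r) * |lam - 1| ^ (-1 / ((n : ℝ) + 2)) *
              |lam| ^ (-((n : ℝ) + 1) / ((n : ℝ) + 2)) * |B| ^ (1 / ((n : ℝ) + 2)) *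
              |r| ^ (((n : ℝ) + 1) * (lam - 2) / (((n : ℝ) + 2) * lam) -
                ((n : ℝ) + 1) / ((n : ℝ) + 2)))) ∧
        (lam = 0 → ε = 0 →
          φ r = B * Real.exp (-2 * ((n : ℝ) + 1) * r / α) ∧
          ψ r = -α * φ r ∧
          AffineSphere.HasAffineMeanCurvature {x ∈ Ω | F x = r} (AffineSphere.stdCoorient F)
            (Real.sign α * |α| ^ (-((n : ℝ) + 1) / ((n : ℝ) + 2)) *
              |B| ^ (1 / ((n : ℝ) + 2)) *
              Real.exp (-2 * ((n : ℝ) + 1) * r / (α * ((n : ℝ) + 2))))) ∧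
        (α = 0 → ε = 1 →
          φ r = B * r ^ (n + 1) ∧
          ψ r = r * φ r ∧
          AffineSphere.HasAffineMeanCurvature {x ∈ Ω | F x = r} (AffineSphere.stdCoorient F)
            0)) := by
  have hE := hF.isEulerRegularOn hΩ hI hIreg
  have hn0 := Nat.one_le_iff_ne_zero.1 hn
  rw [AffineSphere.exists_comp_eq_iff, AffineSphere.exists_comp_eq_iff]
  refine ⟨forall₂_congr fun r hr => ?_, ?_, ?_, fun φ ψ hφ0 _ hφ hψ hconn => ?_⟩
  · simpa only [AffineSphere.levelSet_inter_preimage hr] using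
      hE.exists_hessDet_eq_iff_exists_adjQuad_eq (sub_ne_zero.2 hlam) (hIreg r hr)
  · rintro rfl
    refine forall₂_congr fun r hr => ?_
    simpa only [AffineSphere.levelSet_inter_preimage hr] using
      hE.exists_hessDet_eq_iff_isProperAffineSphere hn0 (by simpa using hlam) (hIreg r hr)
  · rintro rfl
    refine forall₂_congr fun r hr => ?_
    simpa only [AffineSphere.levelSet_inter_preimage hr] using
      hE.exists_hessDet_eq_iff_isImproperAffineSphere (by simpa using hlam) (hIreg r hr)
  · have hprofile : AffineSphere.IsProfile lam ε α Ω I v F φ ψ :=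
      ⟨hF, hΩ, hI, hIreg, hφ0, hφ, hψ⟩
    rcases hε with rfl | rfl
    · rcases mul_eq_zero.1 hαlam with rfl | rfl
      · have hlam0 : lam ≠ 0 := fun h => hne ⟨rfl, h⟩
        obtain ⟨B, hB, h⟩ := hprofile.exists_power_law hn0 hlam0 (by simpa using hlam) hconn
        exact ⟨B, hB, fun r hr => ⟨fun _ _ => h r hr, by simp [hlam0], by simp⟩⟩
      · have hα0 : α ≠ 0 := fun h => hne ⟨h, rfl⟩
        obtain ⟨B, hB, h⟩ := hprofile.exists_exponential_law hn0 hα0 hconn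
        exact ⟨B, hB, fun r hr => ⟨by simp [hα0], fun _ _ => h r hr, by simp⟩⟩
    · obtain rfl : α = 0 := by simpa using hαε
      obtain ⟨B, hB, h⟩ := hprofile.exists_polynomial_law hn0 (by simpa using hlam) hconn
      exact ⟨B, hB, fun r hr => ⟨by simp, by simp, fun _ _ => h r hr⟩⟩
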